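/- Setting. Let $\mathbb{G}=(\mathbb{R}^N,\circ)$, $N\ge 1$, be a stratified Lie group (homogeneous Carnot group): a Lie group structure on $\mathbb{R}^N=\mathbb{R}^{N_1}\times\cdots\times\mathbb{R}^{N_k}$ such that the dilations $D_r(x)=(r x^{(1)},r^2x^{(2)},\dots,r^kx^{(k)})$, $r>0$, are automorphisms, and such that the left-invariant vector fields $X_1,\dots,X_{N_1}$ with $X_j(0)=\partial/\partial x_j|_0$, together with their iterated commutators, span $\mathbb{R}^N$ at every point. Let $Q=N_1+2N_2+\cdots+kN_k$ be its homogeneous dimension. Let $|\cdot|$ be a homogeneous quasi-norm on $\mathbb{G}$: a continuous function $\mathbb{G}\to[0,\infty)$ with $|x|=0$ iff $x=0$, $|x^{-1}|=|x|$, and $|D_r x|=r|x|$ for $r>0$. Integrals are with respect to Lebesgue measure on $\mathbb{R}^N$, which is the Haar measure of $\mathbb{G}$. Let $\Omega\subset\mathbb{G}$ be a nonempty bounded open set, and let $0<s<1$, $p>1$, $sp>Q$. Put $$X_0^{s,p}(\Omega)=\Big\{u\in L^p(\mathbb{G}) : \|u\|_{X_0^{s,p}(\Omega)}<\infty,\ u=0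 \text{ a.e. in } \mathbb{G}\setminus\Omega\Big\},\qquad \|u\|_{X_0^{s,p}(\Omega)}=\Big(\int_{\mathbb{G}}\int_{\mathbb{G}}\frac{|u(x)-u(y)|^p}{|y^{-1}x|^{Q+ps}}\,dx\,dy\Big)^{1/p}.$$ Let $\beta\in L^\infty(\Omega)$ with $\operatorname{ess\,inf}_{\Omega}\beta>0$, let $g:\mathbb{R}\to\mathbb{R}$ be continuous, and let $G(\tau)=\int_0^\tau g(\xi)\,d\xi$. For $\lambda>0$, a weak solution of $$(-\Delta_{\mathbb{G},p})^su=\lambda\beta(x)g(u)\ \text{ in }\Omega,\qquad u=0\ \text{ in }\mathbb{G}\setminus\Omega \tag{P}$$ is a function $u\in X_0^{s,p}(\Omega)\setminus\{0\}$ such that, for every $\varphi\in X_0^{s,p}(\Omega)$, both integrals below converge absolutely and $$\int_{\mathbb{G}}\int_{\mathbb{G}}\frac{|u(x)-u(y)|^{p-2}(u(x)-u(y))(\varphi(x)-\varphi(y))}{|y^{-1}x|^{Q+sp}}\,dx\,dy=\lambda\int_\Omega\beta(x)g(u)\varphi\,dx .$$ Theorem. Let $M$ be either $0^+$ or $+\infty$.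 Suppose that $g\ge 0$, that $g(0)=0$, and that $$\liminf_{\tau\to M}\frac{G(\tau)}{\tau^p}=0,\qquad \limsup_{\tau\to M}\frac{G(\tau)}{\tau^p}=+\infty .$$ Then, for every $\lambda>0$, problem (P) has a sequence $\{u_{\lambda,n}\}\subset X_0^{s,p}(\Omega)$ of (a.e.) nonnegative weak solutions. Moreover, if $M=+\infty$, then $$\lim_{n\to\infty}\|u_{\lambda,n}\|_{X_0^{s,p}(\Omega)}=+\infty,$$ and if $M=0^+$, then $$\lim_{n\to\infty}\|u_{\lambda,n}\|_{X_0^{s,p}(\Omega)}=\lim_{n\to\infty}\|u_{\lambda,n}\|_{L^\infty(\Omega)}=0.$$ -/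

import Mathlib

open MeasureTheory Filter Topology
open scoped ContDiff ENNReal

noncomputable section

namespace Carnot

/-- The dilation `x ↦ (r ^ w₁ x₁, …, r ^ w_N x_N)` of `ℝ^N` with integer weights `w`. -/
def dilation {N : ℕ} (w : Fin N → ℕ) (r : ℝ) (x : Fin N → ℝ) : Fin N → ℝ :=
  fun i => r ^ w i * x i

/-- The left-invariant vector field, for the group law `mul` with neutral element `0`, that takes
the value `∂/∂x_j` at `0`: its value at `x` is the image of `e_j` under the differential at `0`
of the left translation `y ↦ mul x y`. -/
def leftField {N : ℕ} (mul : (Fin N → ℝ) → (Fin N → ℝ) → (Fin N → ℝ)) (j : Fin N) :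
    (Fin N → ℝ) → (Fin N → ℝ) :=
  fun x => fderiv ℝ (fun y => mul x y) 0 (Pi.single j 1)

/-- The iterated commutators (of any length, including length one) of the vector fields in `S`.
Their linear span is the Lie algebra generated by `S`. -/
inductive IsIteratedBracket {N : ℕ} (S : Set ((Fin N → ℝ) → (Fin N → ℝ))) :
    ((Fin N → ℝ) → (Fin N → ℝ)) → Prop
  | of (V : (Fin N → ℝ) → (Fin N → ℝ)) : V ∈ S → IsIteratedBracket S V
  | bracket (V W : (Fin N → ℝ) → (Fin N → ℝ)) : IsIteratedBracket S V → IsIteratedBracket S W →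
      IsIteratedBracket S (VectorField.lieBracket ℝ V W)

/-- A stratified Lie group (homogeneous Carnot group) on `ℝ^N`: a Lie group law on `ℝ^N` for which
the dilations `(r x⁽¹⁾, r² x⁽²⁾, …, r^k x⁽ᵏ⁾)`, `r > 0`, are automorphisms, where
`ℝ^N = ℝ^{N₁} × ⋯ × ℝ^{N_k}`, and whose left-invariant vector fields extending `∂/∂x_j|₀`,
`j = 1, …, N₁`, satisfy Hörmander's condition.
The block structure is encoded by the weights: `weight i` is the index of the block of the
coordinate `x_i`, so that `N_l` is the number of coordinates of weight `l`.
The neutral element is `0`, as it is fixed by all the dilations. -/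
structure StratifiedGroup (N : ℕ) where
  mul : (Fin N → ℝ) → (Fin N → ℝ) → (Fin N → ℝ)
  inv : (Fin N → ℝ) → (Fin N → ℝ)
  mul_assoc : ∀ x y z, mul (mul x y) z = mul x (mul y z)
  zero_mul : ∀ x, mul 0 x = x
  mul_zero : ∀ x, mul x 0 = x
  inv_mul : ∀ x, mul (inv x) x = 0
  contDiff_mul : ContDiff ℝ ∞ (fun z : (Fin N → ℝ) × (Fin N → ℝ) => mul z.1 z.2)
  contDiff_inv : ContDiff ℝ ∞ inv
  weight : Fin N → ℕ
  weight_pos : ∀ i, 1 ≤ weight i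
  weight_mono : Monotone weight
  dilation_mul : ∀ r : ℝ, 0 < r → ∀ x y,
    dilation weight r (mul x y) = mul (dilation weight r x) (dilation weight r y)
  hormander : ∀ x : Fin N → ℝ,
    Submodule.span ℝ {v : Fin N → ℝ | ∃ V : (Fin N → ℝ) → (Fin N → ℝ),
      IsIteratedBracket {X | ∃ j, weight j = 1 ∧ X = leftField mul j} V ∧ v = V x} = ⊤

/-- The homogeneous dimension `Q = N₁ + 2 N₂ + ⋯ + k N_k`. -/
def StratifiedGroup.homDim {N : ℕ} (𝔾 : StratifiedGroup N) : ℕ := ∑ i, 𝔾.weight i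

/-- A homogeneous quasi-norm on a stratified group. -/
structure QuasiNorm {N : ℕ} (𝔾 : StratifiedGroup N) where
  nrm : (Fin N → ℝ) → ℝ
  nonneg : ∀ x, 0 ≤ nrm x
  continuous_nrm : Continuous nrm
  eq_zero_iff : ∀ x, nrm x = 0 ↔ x = 0
  nrm_inv : ∀ x, nrm (𝔾.inv x) = nrm x
  nrm_dilation : ∀ r : ℝ, 0 < r → ∀ x, nrm (dilation 𝔾.weight r x) = r * nrm x

variable {N : ℕ} {𝔾 : StratifiedGroup N}

/-- The left-invariant homogeneous distance `d(x, y) = |y⁻¹ ∘ x|`. -/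
def QuasiNorm.dist (ν : QuasiNorm 𝔾) (x y : Fin N → ℝ) : ℝ := ν.nrm (𝔾.mul (𝔾.inv y) x)

/-- The `p`-th power `∬ |u(x) - u(y)|^p / |y⁻¹x|^(Q+ps) dx dy` of the Gagliardo semi-norm on `𝔾`.
The Haar measure of `𝔾` is the Lebesgue measure of `ℝ^N`. -/
def gagliardoEnergy (ν : QuasiNorm 𝔾) (s p : ℝ) (u : (Fin N → ℝ) → ℝ) : ℝ≥0∞ :=
  ∫⁻ y, ∫⁻ x, ENNReal.ofReal (|u x - u y| ^ p / ν.dist x y ^ ((𝔾.homDim : ℝ) + p * s))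

/-- Membership in `W^{s,p}(𝔾)`. -/
def MemW (ν : QuasiNorm 𝔾) (s p : ℝ) (u : (Fin N → ℝ) → ℝ) : Prop :=
  MemLp u (ENNReal.ofReal p) volume ∧ gagliardoEnergy ν s p u < (⊤ : ℝ≥0∞)

/-- Membership in `X₀^{s,p}(Ω) = {u ∈ W^{s,p}(𝔾) : u = 0 in 𝔾 ∖ Ω}`; elements are functions
understood up to equality almost everywhere. -/
def MemX₀ (ν : QuasiNorm 𝔾) (s p : ℝ) (Ω : Set (Fin N → ℝ)) (u : (Fin N → ℝ) → ℝ) : Prop :=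
  MemW ν s p u ∧ ∀ᵐ x ∂volume, x ∉ Ω → u x = 0

/-- The norm of `X₀^{s,p}(Ω)`, that is, the Gagliardo semi-norm on `𝔾`. -/
def normX₀ (ν : QuasiNorm 𝔾) (s p : ℝ) (u : (Fin N → ℝ) → ℝ) : ℝ :=
  (gagliardoEnergy ν s p u).toReal ^ (1 / p)

/-- The integrand of the weak form of the fractional `p`-sub-Laplacian at a pair of points. -/
def weakKernel (ν : QuasiNorm 𝔾) (s p : ℝ) (u φ : (Fin N → ℝ) → ℝ)
    (z : (Fin N → ℝ) × (Fin N → ℝ)) : ℝ :=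
  |u z.1 - u z.2| ^ (p - 2) * (u z.1 - u z.2) * (φ z.1 - φ z.2) /
    ν.dist z.1 z.2 ^ ((𝔾.homDim : ℝ) + s * p)

/-- `u` is a (nontrivial) weak solution of `(-Δ_{𝔾,p})^s u = lam β g(u)` in `Ω`, `u = 0` in
`𝔾 ∖ Ω`. Both integrals are required to converge absolutely. -/
def IsWeakSolution (ν : QuasiNorm 𝔾) (s p : ℝ) (Ω : Set (Fin N → ℝ)) (β : (Fin N → ℝ) → ℝ)
    (g : ℝ → ℝ) (lam : ℝ) (u : (Fin N → ℝ) → ℝ) : Prop :=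
  MemX₀ ν s p Ω u ∧ ¬ (u =ᵐ[volume] 0) ∧
    ∀ φ : (Fin N → ℝ) → ℝ, MemX₀ ν s p Ω φ →
      Integrable (weakKernel ν s p u φ) (volume.prod volume) ∧
      IntegrableOn (fun x => β x * g (u x) * φ x) Ω volume ∧
      ∫ z, weakKernel ν s p u φ z ∂(volume.prod volume) =
        lam * ∫ x in Ω, β x * g (u x) * φ x

/-- The primitive `G(τ) = ∫₀^τ g`. -/
def primitive (g : ℝ → ℝ) (τ : ℝ) : ℝ := ∫ ξ in (0 : ℝ)..τ, g ξ

/-- `liminf_{τ → M} G(τ)/τ^p = 0` and `limsup_{τ → M} G(τ)/τ^p = +∞`, where `τ → M` is the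
filter `l`; both limits are taken in the extended real line. -/
def Oscillates (g : ℝ → ℝ) (p : ℝ) (l : Filter ℝ) : Prop :=
  liminf (fun τ : ℝ => ((primitive g τ / τ ^ p : ℝ) : EReal)) l = 0 ∧
    limsup (fun τ : ℝ => ((primitive g τ / τ ^ p : ℝ) : EReal)) l = ⊤

end Carnot

end

/-! Put `I(u) = ‖u‖^p / p - λ ∫_Ω β G(u)`, with `‖·‖` the norm of `X₀`; interior local minimisers of
`I` satisfy the weak equation. Since `sp > Q`, Morrey's inequality (`exists_morrey`) gives `|u| ≤ C
‖u‖` a.e. (`exists_abs_le_normX₀`) and a.e. convergent subsequences of bounded sequences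
(`exists_subseq_tendsto_ae`). So the direct method minimises `I` on every closed ball of `X₀`
(`exists_minimizer`), and passing to `|u|` does not raise `I`.

On the ball of radius `b / C` all functions are bounded by `b`, and `G` is nondecreasing, so the
potential is at most `G(b) ∫_Ω β`. The liminf condition makes `G(b) / b^p` small for some `b`
arbitrarily near `M`, and then `I > 0` on the sphere of radius `b / C`. If `I` is negative somewhere
in the ball, the minimiser is therefore interior and nonzero, hence a solution (`exists_solution`).
The limsup condition supplies negative values: for a fixed cut-off `w`, `I(d w) < -d^p` as soon as
`G(d) / d^p` is large (`exists_energyFunctional_lt`).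

For `M = +∞`, `d` is chosen first and `b` afterwards, large enough that the ball contains `d w`. The
minimal values then tend to `-∞`, while `I` is bounded below on each fixed ball
(`neg_le_energyFunctional`), so the norms diverge. For `M = 0⁺`, `b → 0` is chosen first and `d`
afterwards; the bounds `b / C` on the norm and `b` on the supremum give both limits.

The group enters through left-invariance of Lebesgue measure, the volume `c r^Q` of quasi-balls and
a quasi-triangle inequality. Morrey's inequality follows by telescoping averages over shrinking
balls. -/

namespace Carnot

variable {N : ℕ}

/-! ### Group identities and left-invariance of Lebesgue measure. -/

namespace StratifiedGroup

variable (𝔾 : StratifiedGroup N)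

theorem inv_mul_cancel_left (x y : Fin N → ℝ) : 𝔾.mul (𝔾.inv x) (𝔾.mul x y) = y := by
  rw [← 𝔾.mul_assoc, 𝔾.inv_mul, 𝔾.zero_mul]

theorem mul_inv (x : Fin N → ℝ) : 𝔾.mul x (𝔾.inv x) = 0 := by
  rw [← 𝔾.inv_mul_cancel_left (𝔾.inv x) (𝔾.mul x (𝔾.inv x)), 𝔾.inv_mul_cancel_left x, 𝔾.inv_mul]

theorem mul_inv_cancel_left (x y : Fin N → ℝ) : 𝔾.mul x (𝔾.mul (𝔾.inv x) y) = y := by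
  rw [← 𝔾.mul_assoc, 𝔾.mul_inv, 𝔾.zero_mul]

theorem eq_inv_of_mul_eq_zero {x y : Fin N → ℝ} (h : 𝔾.mul x y = 0) : y = 𝔾.inv x := by
  rw [← 𝔾.inv_mul_cancel_left x y, h, 𝔾.mul_zero]

theorem inv_inv_mul (x y : Fin N → ℝ) :
    𝔾.inv (𝔾.mul (𝔾.inv y) x) = 𝔾.mul (𝔾.inv x) y := by
  refine (𝔾.eq_inv_of_mul_eq_zero ?_).symm
  rw [𝔾.mul_assoc, 𝔾.mul_inv_cancel_left, 𝔾.inv_mul]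

theorem continuous_mul : Continuous fun z : (Fin N → ℝ) × (Fin N → ℝ) => 𝔾.mul z.1 z.2 :=
  𝔾.contDiff_mul.continuous

theorem continuous_inv : Continuous 𝔾.inv := 𝔾.contDiff_inv.continuous

theorem continuous_mul_left (x : Fin N → ℝ) : Continuous (𝔾.mul x) :=
  𝔾.continuous_mul.comp (by fun_prop : Continuous fun y : Fin N → ℝ => (x, y))

/-- The dilation as a continuous linear map. -/
noncomputable def dilationL (w : Fin N → ℕ) (r : ℝ) : (Fin N → ℝ) →L[ℝ] (Fin N → ℝ) :=
  ContinuousLinearMap.pi fun i => (r ^ w i) • ContinuousLinearMap.proj i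

theorem dilationL_apply (w : Fin N → ℕ) (r : ℝ) (x : Fin N → ℝ) :
    dilationL w r x = dilation w r x := rfl

theorem det_dilationL (r : ℝ) : (dilationL 𝔾.weight r).det = r ^ 𝔾.homDim := by
  have h : (dilationL 𝔾.weight r : (Fin N → ℝ) →ₗ[ℝ] (Fin N → ℝ)) =
      Matrix.toLin' (Matrix.diagonal fun i => r ^ 𝔾.weight i) := by
    ext i j
    simp [dilationL, Matrix.mulVec_diagonal]
  rw [ContinuousLinearMap.det, h, LinearMap.det_toLin', Matrix.det_diagonal,
    Finset.prod_pow_eq_pow_sum, StratifiedGroup.homDim]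

/-- The differential of the left translation by `x`, at `y`. -/
noncomputable def dLeft (x y : Fin N → ℝ) : (Fin N → ℝ) →L[ℝ] (Fin N → ℝ) :=
  (fderiv ℝ (fun z : (Fin N → ℝ) × (Fin N → ℝ) => 𝔾.mul z.1 z.2) (x, y)).comp
    (ContinuousLinearMap.inr ℝ (Fin N → ℝ) (Fin N → ℝ))

theorem hasFDerivAt_mul_left (x y : Fin N → ℝ) : HasFDerivAt (𝔾.mul x) (𝔾.dLeft x y) y := by
  have h1 : HasFDerivAt (fun z : (Fin N → ℝ) × (Fin N → ℝ) => 𝔾.mul z.1 z.2) _ (x, y) :=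
    (𝔾.contDiff_mul.differentiable (by simp) (x, y)).hasFDerivAt
  exact h1.comp y (hasFDerivAt_prodMk_right x y)

theorem continuous_det_dLeft :
    Continuous fun z : (Fin N → ℝ) × (Fin N → ℝ) => (𝔾.dLeft z.1 z.2).det := by
  refine ContinuousLinearMap.continuous_det.comp ?_
  exact (𝔾.contDiff_mul.continuous_fderiv (by simp)).clm_comp continuous_const

/-- Dilations are automorphisms, so they intertwine the two left translations; in the chain rule
both sides carry the same nonzero factor `det D_r`, which cancels. -/
theorem det_dLeft_dilation {r : ℝ} (hr : 0 < r) (x y : Fin N → ℝ) :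
    (𝔾.dLeft (dilation 𝔾.weight r x) (dilation 𝔾.weight r y)).det = (𝔾.dLeft x y).det := by
  have h1 : HasFDerivAt (𝔾.mul (dilation 𝔾.weight r x) ∘ dilationL 𝔾.weight r) _ y :=
    (𝔾.hasFDerivAt_mul_left (dilation 𝔾.weight r x) (dilation 𝔾.weight r y)).comp y
      (dilationL 𝔾.weight r).hasFDerivAt
  have h2 := (dilationL 𝔾.weight r).hasFDerivAt.comp y (𝔾.hasFDerivAt_mul_left x y)
  have h3 : (𝔾.mul (dilation 𝔾.weight r x) ∘ dilationL 𝔾.weight r) =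
      dilationL 𝔾.weight r ∘ 𝔾.mul x := by
    funext z
    exact (𝔾.dilation_mul r hr x z).symm
  rw [h3] at h1
  have h4 := congrArg ContinuousLinearMap.det (h1.unique h2)
  simp only [ContinuousLinearMap.det, ContinuousLinearMap.toLinearMap_comp, LinearMap.det_comp] at h4
  have h5 : LinearMap.det (dilationL 𝔾.weight r : (Fin N → ℝ) →ₗ[ℝ] (Fin N → ℝ)) ≠ 0 := by
    have := 𝔾.det_dilationL r
    rw [ContinuousLinearMap.det] at this
    rw [this]
    positivity
  rw [mul_comm] at h4
  exact mul_left_cancel₀ h5 h4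

theorem tendsto_dilation_zero (x : Fin N → ℝ) :
    Tendsto (fun r => dilation 𝔾.weight r x) (𝓝[>] 0) (𝓝 0) := by
  have h : Continuous fun r => dilation 𝔾.weight r x := by
    unfold dilation
    fun_prop
  have h0 : dilation 𝔾.weight 0 x = 0 := by
    funext i
    simp [dilation, (Nat.pos_iff_ne_zero.mp (𝔾.weight_pos i))]
  have := h.tendsto 0
  rw [h0] at this
  exact this.mono_left nhdsWithin_le_nhds

/-- The Jacobian is continuous and constant along `r ↦ (D_r x, D_r y)`. Letting `r → 0⁺` compares it
with its value at the origin, where the left translation is the identity. -/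
theorem det_dLeft (x y : Fin N → ℝ) : (𝔾.dLeft x y).det = 1 := by
  have h1 : Tendsto (fun r => (𝔾.dLeft (dilation 𝔾.weight r x) (dilation 𝔾.weight r y)).det)
      (𝓝[>] 0) (𝓝 (𝔾.dLeft 0 0).det) :=
    (𝔾.continuous_det_dLeft.tendsto (0, 0)).comp
      ((𝔾.tendsto_dilation_zero x).prodMk_nhds (𝔾.tendsto_dilation_zero y))
  have h2 : Tendsto (fun r => (𝔾.dLeft (dilation 𝔾.weight r x) (dilation 𝔾.weight r y)).det)
      (𝓝[>] 0) (𝓝 (𝔾.dLeft x y).det) := by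
    refine tendsto_const_nhds.congr' ?_
    filter_upwards [self_mem_nhdsWithin] with r hr
    exact (𝔾.det_dLeft_dilation hr x y).symm
  have h3 : 𝔾.dLeft 0 0 = ContinuousLinearMap.id ℝ _ := by
    refine (𝔾.hasFDerivAt_mul_left 0 0).unique ?_
    have : 𝔾.mul 0 = id := funext 𝔾.zero_mul
    rw [this]
    exact hasFDerivAt_id _
  rw [tendsto_nhds_unique h2 h1, h3]
  simp [ContinuousLinearMap.det]

theorem mul_left_injective (x : Fin N → ℝ) : Function.Injective (𝔾.mul x) := fun a b h => by
  rw [← 𝔾.inv_mul_cancel_left x a, h, 𝔾.inv_mul_cancel_left]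

/-- Lebesgue measure is left-invariant. -/
theorem measurePreserving_mul_left (x : Fin N → ℝ) :
    MeasurePreserving (𝔾.mul x) volume volume := by
  refine ⟨(𝔾.continuous_mul_left x).measurable, ?_⟩
  ext s hs
  rw [Measure.map_apply (𝔾.continuous_mul_left x).measurable hs]
  -- Rewriting the preimage as an image under an injective map makes the change of variables formula
  -- applicable, with Jacobian 1.
  have h1 : 𝔾.mul x ⁻¹' s = 𝔾.mul (𝔾.inv x) '' s := by
    ext y
    constructor
    · exact fun hy => ⟨_, hy, 𝔾.inv_mul_cancel_left x y⟩
    · rintro ⟨z, hz, rfl⟩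
      simpa [𝔾.mul_inv_cancel_left] using hz
  rw [h1, ← lintegral_abs_det_fderiv_eq_addHaar_image volume hs
    (fun y _ => (𝔾.hasFDerivAt_mul_left (𝔾.inv x) y).hasFDerivWithinAt)
    (𝔾.mul_left_injective _).injOn]
  simp [det_dLeft]

theorem dilation_dilation_inv {r : ℝ} (hr : r ≠ 0) (x : Fin N → ℝ) :
    dilation 𝔾.weight r (dilation 𝔾.weight r⁻¹ x) = x := by
  funext i
  simp [dilation, hr]

end StratifiedGroup

/-! ### Geometry of the quasi-norm: compact balls, quasi-triangle inequality, volumes. -/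

variable {𝔾 : StratifiedGroup N}

namespace QuasiNorm

variable (ν : QuasiNorm 𝔾)

theorem dist_comm (x y : Fin N → ℝ) : ν.dist x y = ν.dist y x := by
  rw [QuasiNorm.dist, ← ν.nrm_inv, 𝔾.inv_inv_mul, QuasiNorm.dist]

theorem dist_nonneg (x y : Fin N → ℝ) : 0 ≤ ν.dist x y := ν.nonneg _

theorem dist_self (x : Fin N → ℝ) : ν.dist x x = 0 := by
  rw [QuasiNorm.dist, 𝔾.inv_mul, ν.eq_zero_iff]

theorem dist_eq_zero {x y : Fin N → ℝ} (h : ν.dist x y = 0) : x = y := by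
  have h1 := (ν.eq_zero_iff _).mp h
  have := 𝔾.mul_inv_cancel_left y x
  rw [h1, 𝔾.mul_zero] at this
  exact this.symm

theorem continuous_dist :
    Continuous fun z : (Fin N → ℝ) × (Fin N → ℝ) => ν.dist z.1 z.2 :=
  ν.continuous_nrm.comp (𝔾.continuous_mul.comp
    ((𝔾.continuous_inv.comp continuous_snd).prodMk continuous_fst))

/-- Small quasi-balls are bounded. -/
theorem exists_norm_le_one_of_nrm_lt :
    ∃ m : ℝ, 0 < m ∧ ∀ x, ν.nrm x < m → ‖x‖ ≤ 1 := by
  obtain ⟨m, hm, hms⟩ : ∃ m : ℝ, 0 < m ∧ ∀ x, ‖x‖ = 1 → m ≤ ν.nrm x := by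
    -- The sphere is empty when `N = 0`; otherwise the minimum of the quasi-norm on it is positive.
    rcases (Metric.sphere (0 : Fin N → ℝ) 1).eq_empty_or_nonempty with h | h
    · refine ⟨1, one_pos, fun x hx => ?_⟩
      have : x ∈ Metric.sphere (0 : Fin N → ℝ) 1 := by simpa using hx
      simp [h] at this
    · obtain ⟨x, hx, hmin⟩ := (isCompact_sphere (0 : Fin N → ℝ) 1).exists_isMinOn h
        ν.continuous_nrm.continuousOn
      refine ⟨ν.nrm x, (ν.nonneg x).lt_of_ne' ?_, fun y hy => hmin (by simpa using hy)⟩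
      rw [ne_eq, ν.eq_zero_iff]
      rintro rfl
      simp at hx
  refine ⟨m, hm, fun x hx => ?_⟩
  by_contra! hx1
  have hc : Continuous fun r => ‖dilation 𝔾.weight r x‖ := by
    unfold dilation
    fun_prop
  have h0 : dilation 𝔾.weight 0 x = 0 := by
    funext i
    simp [dilation, (Nat.pos_iff_ne_zero.mp (𝔾.weight_pos i))]
  have h1 : dilation 𝔾.weight 1 x = x := by
    funext i
    simp [dilation]
  -- The path `r ↦ D_r x` joins `0` to `x`, so it meets the unit sphere at some `r ≤ 1`. There the
  -- quasi-norm is `r |x| ≤ |x| < m`, contradicting the choice of `m`.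
  obtain ⟨r, hr, hr1⟩ := intermediate_value_Icc (zero_le_one' ℝ) hc.continuousOn
    (show (1 : ℝ) ∈ Set.Icc _ _ by simp [h0, h1, hx1.le])
  have hr0 : 0 < r := by
    refine hr.1.lt_of_ne ?_
    rintro rfl
    simp [h0] at hr1
  have := hms _ hr1
  rw [ν.nrm_dilation r hr0] at this
  nlinarith [ν.nonneg x, hr.2]

/-- A small dilation moves the quasi-ball into the Euclidean unit ball, so it is a closed subset of
a linear image of a compact set. -/
theorem isCompact_closedBall (R : ℝ) : IsCompact {x | ν.nrm x ≤ R} := by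
  obtain ⟨m, hm, h⟩ := ν.exists_norm_le_one_of_nrm_lt
  obtain ⟨r, hr, hrR⟩ : ∃ r : ℝ, 0 < r ∧ r * R < m := by
    refine ⟨m / (|R| + 1), by positivity, ?_⟩
    rw [div_mul_eq_mul_div, div_lt_iff₀ (by positivity)]
    nlinarith [le_abs_self R]
  have hsub : {x | ν.nrm x ≤ R} ⊆
      StratifiedGroup.dilationL 𝔾.weight r⁻¹ '' Metric.closedBall 0 1 := by
    intro x hx
    refine ⟨dilation 𝔾.weight r x, ?_, ?_⟩
    · rw [mem_closedBall_zero_iff]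
      refine h _ ?_
      rw [ν.nrm_dilation r hr]
      exact (mul_le_mul_of_nonneg_left hx hr.le).trans_lt hrR
    · rw [StratifiedGroup.dilationL_apply]
      simpa using 𝔾.dilation_dilation_inv (inv_ne_zero hr.ne') x
  exact ((ProperSpace.isCompact_closedBall _ _).image (ContinuousLinearMap.continuous _)).of_isClosed_subset
    (isClosed_le ν.continuous_nrm continuous_const) hsub

/-- By homogeneity it suffices to take `r = 1`, where the quasi-norm of the product is bounded by
compactness. The degenerate case `r = 0` is separate. -/
theorem exists_nrm_mul_le : ∃ K : ℝ, 1 ≤ K ∧ ∀ x y r, ν.nrm x ≤ r → ν.nrm y ≤ r →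
    ν.nrm (𝔾.mul x y) ≤ K * r := by
  obtain ⟨K, hK⟩ := ((ν.isCompact_closedBall 1).prod (ν.isCompact_closedBall 1)).bddAbove_image
    (ν.continuous_nrm.comp 𝔾.continuous_mul).continuousOn
  refine ⟨max K 1, le_max_right _ _, fun x y r hx hy => ?_⟩
  rcases ((ν.nonneg x).trans hx).eq_or_lt with rfl | hr
  · have hx0 := (ν.eq_zero_iff x).mp (le_antisymm hx (ν.nonneg x))
    have hy0 := (ν.eq_zero_iff y).mp (le_antisymm hy (ν.nonneg y))
    rw [hx0, hy0, 𝔾.mul_zero, (ν.eq_zero_iff 0).mpr rfl]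
    simp
  · have hi : 0 < r⁻¹ := inv_pos.mpr hr
    have hb : ∀ z, ν.nrm z ≤ r → ν.nrm (dilation 𝔾.weight r⁻¹ z) ≤ 1 := fun z hz => by
      rw [ν.nrm_dilation _ hi, inv_mul_le_iff₀ hr, mul_one]
      exact hz
    have h1 := hK ⟨(dilation 𝔾.weight r⁻¹ x, dilation 𝔾.weight r⁻¹ y),
      ⟨hb x hx, hb y hy⟩, rfl⟩
    simp only [Function.comp_apply] at h1
    rw [← 𝔾.dilation_mul _ hi, ν.nrm_dilation _ hi, inv_mul_le_iff₀ hr] at h1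
    rw [mul_comm]
    exact h1.trans (mul_le_mul_of_nonneg_left (le_max_left _ _) hr.le)

theorem exists_dist_le : ∃ K : ℝ, 1 ≤ K ∧ ∀ x y z r, ν.dist x y ≤ r → ν.dist y z ≤ r →
    ν.dist x z ≤ K * r := by
  obtain ⟨K, hK1, hK⟩ := ν.exists_nrm_mul_le
  refine ⟨K, hK1, fun x y z r hxy hyz => ?_⟩
  have := hK _ _ r hyz hxy
  rwa [𝔾.mul_assoc, 𝔾.mul_inv_cancel_left] at this

/-- The quasi-ball of centre `x` and radius `r`. -/
def ball (x : Fin N → ℝ) (r : ℝ) : Set (Fin N → ℝ) := {y | ν.dist x y < r}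

theorem isOpen_ball (x : Fin N → ℝ) (r : ℝ) : IsOpen (ν.ball x r) :=
  isOpen_lt (ν.continuous_dist.comp (by fun_prop : Continuous fun y => (x, y))) continuous_const

theorem measurableSet_ball (x : Fin N → ℝ) (r : ℝ) : MeasurableSet (ν.ball x r) :=
  (ν.isOpen_ball x r).measurableSet

theorem measurableSet_nrm_lt (r : ℝ) : MeasurableSet {y | ν.nrm y < r} :=
  (isOpen_lt ν.continuous_nrm continuous_const).measurableSet

theorem volume_nrm_lt {r : ℝ} (hr : 0 < r) :
    volume {y | ν.nrm y < r} = ENNReal.ofReal (r ^ 𝔾.homDim) * volume {y | ν.nrm y < 1} := by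
  have h : {y | ν.nrm y < r} =
      StratifiedGroup.dilationL 𝔾.weight r '' {y | ν.nrm y < 1} := by
    ext y
    constructor
    · intro hy
      refine ⟨dilation 𝔾.weight r⁻¹ y, ?_, 𝔾.dilation_dilation_inv hr.ne' y⟩
      rw [Set.mem_ofPred_eq, ν.nrm_dilation _ (inv_pos.mpr hr), inv_mul_lt_iff₀ hr, mul_one]
      exact hy
    · rintro ⟨z, hz, rfl⟩
      rw [Set.mem_ofPred_eq, StratifiedGroup.dilationL_apply, ν.nrm_dilation _ hr]
      simpa using mul_lt_mul_of_pos_left hz hr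
  have h2 := 𝔾.det_dilationL r
  rw [ContinuousLinearMap.det] at h2
  rw [h, Measure.addHaar_image_continuousLinearMap, h2, abs_of_pos (pow_pos hr _)]

theorem volume_nrm_lt_pos : 0 < volume {y | ν.nrm y < 1} :=
  (isOpen_lt ν.continuous_nrm continuous_const).measure_pos _
    ⟨0, by simp [(ν.eq_zero_iff 0).mpr rfl]⟩

theorem volume_nrm_lt_lt_top (r : ℝ) : volume {y | ν.nrm y < r} < ⊤ :=
  (measure_mono (show {y | ν.nrm y < r} ⊆ {y | ν.nrm y ≤ r} from
    fun y hy => show ν.nrm y ≤ r from le_of_lt hy)).trans_lt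
    (ν.isCompact_closedBall r).measure_lt_top

theorem volume_ball (x : Fin N → ℝ) (r : ℝ) :
    volume (ν.ball x r) = volume {y | ν.nrm y < r} := by
  rw [← (𝔾.measurePreserving_mul_left (𝔾.inv x)).measure_preimage
    (ν.measurableSet_nrm_lt r).nullMeasurableSet]
  congr 1
  ext y
  rw [ball, Set.mem_ofPred_eq, ν.dist_comm]
  rfl

/-- Left-invariance moves the centre to `0`, and the dilation `D_r` has determinant `r^Q`. The
exponent is cast to a real so that it combines with `Q + ps`. -/
theorem exists_volume_ball_eq : ∃ c : ℝ, 0 < c ∧ ∀ x r, 0 < r →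
    volume (ν.ball x r) = ENNReal.ofReal (c * r ^ (𝔾.homDim : ℝ)) := by
  refine ⟨(volume {y | ν.nrm y < 1}).toReal,
    ENNReal.toReal_pos ν.volume_nrm_lt_pos.ne' (ν.volume_nrm_lt_lt_top 1).ne, fun x r hr => ?_⟩
  rw [ν.volume_ball, ν.volume_nrm_lt hr, mul_comm (ENNReal.toReal _),
    ENNReal.ofReal_mul (by positivity), ENNReal.ofReal_toReal (ν.volume_nrm_lt_lt_top 1).ne,
    Real.rpow_natCast]

end QuasiNorm

end Carnot

/-! ### Morrey's inequality from averages over quasi-balls. -/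

namespace Carnot

variable {N : ℕ} {𝔾 : StratifiedGroup N}

/-- Jensen's inequality for `|·| ^ p`. -/
theorem ofReal_abs_average_rpow_le {α : Type*} [MeasurableSpace α] {μ : Measure α}
    [IsFiniteMeasure μ] (hμ : μ Set.univ ≠ 0) {f : α → ℝ} (hf : Integrable f μ) {p : ℝ}
    (hp : 1 ≤ p) :
    ENNReal.ofReal (|⨍ x, f x ∂μ| ^ p) ≤
      (μ Set.univ)⁻¹ * ∫⁻ x, ENNReal.ofReal (|f x| ^ p) ∂μ := by
  have hp0 : 0 ≤ p := zero_le_one.trans hp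
  by_cases htop : ∫⁻ x, ENNReal.ofReal (|f x| ^ p) ∂μ = ⊤
  · rw [htop, ENNReal.mul_top]
    · exact le_top
    · simp
  have hmeas : AEStronglyMeasurable (fun x => |f x| ^ p) μ :=
    ((hf.aestronglyMeasurable.norm.aemeasurable).pow_const p).aestronglyMeasurable
  have hnn : ∀ x, 0 ≤ |f x| ^ p := fun x => Real.rpow_nonneg (abs_nonneg _) _
  have hint : Integrable (fun x => |f x| ^ p) μ :=
    (lintegral_ofReal_ne_top_iff_integrable hmeas (ae_of_all _ hnn)).mp htop
  have : NeZero μ := ⟨fun h => hμ (by simp [h])⟩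
  have h1 : (⨍ x, |f x| ∂μ) ^ p ≤ ⨍ x, |f x| ^ p ∂μ :=
    (convexOn_rpow hp).map_average_le
      (Real.continuous_rpow_const hp0).continuousOn isClosed_Ici
      (ae_of_all _ fun x => abs_nonneg (f x)) hf.abs hint
  have h2 : |⨍ x, f x ∂μ| ≤ ⨍ x, |f x| ∂μ := by
    rw [average, average]
    exact abs_integral_le_integral_abs
  have h3 : |⨍ x, f x ∂μ| ^ p ≤ ⨍ x, |f x| ^ p ∂μ :=
    (Real.rpow_le_rpow (abs_nonneg _) h2 hp0).trans h1
  refine (ENNReal.ofReal_le_ofReal h3).trans ?_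
  rw [average_eq, smul_eq_mul, ENNReal.ofReal_mul (by positivity),
    ofReal_integral_eq_lintegral_ofReal hint (ae_of_all _ hnn)]
  gcongr
  rw [Measure.real, ENNReal.ofReal_inv_of_pos
    (ENNReal.toReal_pos hμ (measure_ne_top _ _)), ENNReal.ofReal_toReal (measure_ne_top _ _)]

/-- The integrand of the Gagliardo energy. -/
noncomputable def gagliardoKernel (ν : QuasiNorm 𝔾) (s p : ℝ) (u : (Fin N → ℝ) → ℝ)
    (z : (Fin N → ℝ) × (Fin N → ℝ)) : ℝ :=
  |u z.1 - u z.2| ^ p / ν.dist z.1 z.2 ^ ((𝔾.homDim : ℝ) + p * s)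

section

variable {ν : QuasiNorm 𝔾} {s p : ℝ} {u v : (Fin N → ℝ) → ℝ}

theorem gagliardoKernel_nonneg (z : (Fin N → ℝ) × (Fin N → ℝ)) :
    0 ≤ gagliardoKernel ν s p u z :=
  div_nonneg (Real.rpow_nonneg (abs_nonneg _) _) (Real.rpow_nonneg (ν.dist_nonneg _ _) _)

theorem measurable_dist_rpow (ν : QuasiNorm 𝔾) (e : ℝ) :
    Measurable fun z : (Fin N → ℝ) × (Fin N → ℝ) => ν.dist z.1 z.2 ^ e :=
  ν.continuous_dist.measurable.pow_const e

theorem aemeasurable_gagliardoKernel (hu : AEStronglyMeasurable u volume) :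
    AEMeasurable (gagliardoKernel ν s p u) (volume.prod volume) := by
  have h1 : AEMeasurable (fun z : (Fin N → ℝ) × (Fin N → ℝ) => u z.1) (volume.prod volume) :=
    hu.aemeasurable.comp_fst
  have h2 : AEMeasurable (fun z : (Fin N → ℝ) × (Fin N → ℝ) => u z.2) (volume.prod volume) :=
    hu.aemeasurable.comp_snd
  exact ((h1.sub h2).norm.pow_const p).div (measurable_dist_rpow ν _).aemeasurable

theorem gagliardoEnergy_eq_lintegral_prod (hu : AEStronglyMeasurable u volume) :
    gagliardoEnergy ν s p u =
      ∫⁻ z, ENNReal.ofReal (gagliardoKernel ν s p u z) ∂(volume.prod volume) := by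
  rw [lintegral_prod_symm _ (aemeasurable_gagliardoKernel hu).ennreal_ofReal]
  rfl

/-- Off the diagonal, `dist ^ (Q + ps) ≤ ρ ^ (Q + ps)`; on it the left side vanishes. This converts
oscillation at scale `ρ` into energy. -/
theorem ofReal_abs_sub_rpow_le (hp : 0 < p) (hs : 0 < s) {a b : Fin N → ℝ} {ρ : ℝ}
    (h : ν.dist a b ≤ ρ) :
    ENNReal.ofReal (|u a - u b| ^ p) ≤ ENNReal.ofReal (ρ ^ ((𝔾.homDim : ℝ) + p * s)) *
      ENNReal.ofReal (gagliardoKernel ν s p u (a, b)) := by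
  rw [← ENNReal.ofReal_mul (Real.rpow_nonneg ((ν.dist_nonneg a b).trans h) _)]
  refine ENNReal.ofReal_le_ofReal ?_
  rcases (ν.dist_nonneg a b).eq_or_lt with h0 | h0
  · rw [ν.dist_eq_zero h0.symm, sub_self, abs_zero, Real.zero_rpow hp.ne']
    exact mul_nonneg (Real.rpow_nonneg ((ν.dist_nonneg a b).trans h) _)
      (gagliardoKernel_nonneg _)
  · rw [gagliardoKernel, ← mul_div_assoc, le_div_iff₀ (Real.rpow_pos_of_pos h0 _), mul_comm]
    have : 0 ≤ |u a - u b| ^ p := Real.rpow_nonneg (abs_nonneg _) _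
    gcongr

theorem MemW.integrableOn_ball (hp : 1 < p) (hu : MemW ν s p u) (x : Fin N → ℝ) (r : ℝ) :
    IntegrableOn u (ν.ball x r) := by
  have : IsFiniteMeasure (volume.restrict (ν.ball x r)) :=
    ⟨by simpa [ν.volume_ball] using ν.volume_nrm_lt_lt_top r⟩
  exact (hu.1.restrict _).integrable (by simpa using hp.le)

/-- Averages over comparable balls are close to one another. -/
theorem exists_abs_average_sub_average_le (ν : QuasiNorm 𝔾) (hp : 1 < p) (hs : 0 < s) :
    ∃ C : ℝ, 0 ≤ C ∧ ∀ u : (Fin N → ℝ) → ℝ, MemW ν s p u → ∀ x y : Fin N → ℝ, ∀ r r' : ℝ,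
      0 < r → r / 2 ≤ r' → r' ≤ r → ν.dist x y ≤ r →
      |(⨍ a in ν.ball x r, u a) - ⨍ a in ν.ball y r', u a| ≤
        C * normX₀ ν s p u * r ^ (s - 𝔾.homDim / p) := by
  obtain ⟨K, hK1, hK⟩ := ν.exists_dist_le
  obtain ⟨c, hc, hvol⟩ := ν.exists_volume_ball_eq
  have hK0 : 0 < K := one_pos.trans_le hK1
  set Q : ℝ := (𝔾.homDim : ℝ) with hQ
  have hp0 : 0 < p := one_pos.trans hp
  -- The factors come from the volumes of the two balls, from `r' ≥ r / 2`, and from the bound `K²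
  -- r` for the distance between points of the two balls.
  set A : ℝ := (c * c)⁻¹ * 2 ^ Q * (K * K) ^ (Q + p * s) with hA
  refine ⟨A ^ (1 / p), by positivity, fun u hu x y r r' hr hrr' hr'r hxy => ?_⟩
  have hr' : 0 < r' := by linarith
  have : IsFiniteMeasure (volume.restrict (ν.ball x r)) := ⟨by simp [hvol x r hr]⟩
  have : IsFiniteMeasure (volume.restrict (ν.ball y r')) := ⟨by simp [hvol y r' hr']⟩
  have hmx : (volume.restrict (ν.ball x r)).real Set.univ = c * r ^ Q := by
    rw [Measure.real, Measure.restrict_apply_univ, hvol x r hr, ENNReal.toReal_ofReal]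
    positivity
  have hmy : (volume.restrict (ν.ball y r')).real Set.univ = c * r' ^ Q := by
    rw [Measure.real, Measure.restrict_apply_univ, hvol y r' hr', ENNReal.toReal_ofReal]
    positivity
  have hix : Integrable u (volume.restrict (ν.ball x r)) := hu.integrableOn_ball hp x r
  have hiy : Integrable u (volume.restrict (ν.ball y r')) := hu.integrableOn_ball hp y r'
  set μ := (volume.restrict (ν.ball x r)).prod (volume.restrict (ν.ball y r')) with hμ
  have hμu : μ Set.univ = ENNReal.ofReal (c * r ^ Q * (c * r' ^ Q)) := by
    rw [hμ, ← Set.univ_prod_univ, Measure.prod_prod, Measure.restrict_apply_univ,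
      Measure.restrict_apply_univ, hvol x r hr, hvol y r' hr', ← ENNReal.ofReal_mul]
    positivity
  have hpos : 0 < c * r ^ Q * (c * r' ^ Q) := by positivity
  -- A difference of averages is the average of `u a - u b` over the product of the balls, so Jensen
  -- brings in the double integral.
  have h1 := ofReal_abs_average_rpow_le (μ := μ) (by simp [hμu, hpos])
    (f := fun z => u z.1 - u z.2) ((hix.comp_fst _).sub (hiy.comp_snd _)) hp.le
  have h2 : ⨍ z, (u z.1 - u z.2) ∂μ =
      (⨍ a in ν.ball x r, u a) - ⨍ a in ν.ball y r', u a := by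
    rw [average_eq, average_eq, average_eq, integral_sub (hix.comp_fst _) (hiy.comp_snd _),
      hμ, integral_fun_fst, integral_fun_snd, ← hμ, hmx, hmy, Measure.real, hμu,
      ENNReal.toReal_ofReal hpos.le]
    simp only [smul_eq_mul]
    field_simp
  have h3 : ∫⁻ z, ENNReal.ofReal (|u z.1 - u z.2| ^ p) ∂μ ≤
      ENNReal.ofReal ((K * (K * r)) ^ (Q + p * s)) * gagliardoEnergy ν s p u := by
    rw [gagliardoEnergy_eq_lintegral_prod hu.1.1, ← lintegral_const_mul' _ _ (by simp),
      hμ, Measure.prod_restrict]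
    refine (setLIntegral_mono_ae' ((ν.measurableSet_ball x r).prod (ν.measurableSet_ball y r'))
      (ae_of_all _ ?_)).trans (setLIntegral_le_lintegral _ _)
    rintro ⟨a, b⟩ ⟨ha, hb⟩
    have ha' : ν.dist x a < r := ha
    have hb' : ν.dist y b < r' := hb
    refine ofReal_abs_sub_rpow_le hp0 hs (hK a y b _ (hK a x y r ?_ hxy) ?_)
    · rw [ν.dist_comm]
      exact ha'.le
    · nlinarith
  rw [h2, hμu] at h1
  have h4 := h1.trans (mul_le_mul_right h3 _)
  have hE : gagliardoEnergy ν s p u = ENNReal.ofReal (gagliardoEnergy ν s p u).toReal :=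
    (ENNReal.ofReal_toReal hu.2.ne).symm
  set E := (gagliardoEnergy ν s p u).toReal with hEdef
  have hE0 : 0 ≤ E := ENNReal.toReal_nonneg
  rw [hE, ← ENNReal.ofReal_inv_of_pos hpos, ← ENNReal.ofReal_mul (by positivity),
    ← ENNReal.ofReal_mul (by positivity), ENNReal.ofReal_le_ofReal_iff (by positivity)] at h4
  have h5 : (c * r ^ Q * (c * r' ^ Q))⁻¹ * ((K * (K * r)) ^ (Q + p * s) * E) ≤
      A * r ^ (p * s - Q) * E := by
    have hle : (c * r ^ Q * (c * r' ^ Q))⁻¹ ≤ (c * r ^ Q * (c * (r / 2) ^ Q))⁻¹ := by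
      gcongr
    refine (mul_le_mul_of_nonneg_right hle (by positivity)).trans (le_of_eq ?_)
    rw [Real.div_rpow hr.le zero_le_two, ← mul_assoc K K r,
      Real.mul_rpow (by positivity) hr.le, Real.rpow_add hr, Real.rpow_sub hr, hA]
    have := Real.rpow_pos_of_pos hr Q
    have := Real.rpow_pos_of_pos zero_lt_two Q
    field_simp
  have h6 := Real.rpow_le_rpow (by positivity) (h4.trans h5) (z := 1 / p) (by positivity)
  rw [← Real.rpow_mul (abs_nonneg _), mul_one_div_cancel hp0.ne', Real.rpow_one,
    Real.mul_rpow (by positivity) hE0, Real.mul_rpow (by positivity) (by positivity),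
    ← Real.rpow_mul hr.le] at h6
  refine h6.trans (le_of_eq ?_)
  rw [normX₀, ← hEdef, show (p * s - Q) * (1 / p) = s - Q / p by field_simp]
  ring

/-- At almost every point, averages over small balls converge to the value. -/
theorem MemW.ae_tendsto_average (hp : 1 < p) (hs : 0 < s) (hu : MemW ν s p u) :
    ∀ᵐ x ∂volume, Tendsto (fun r => ⨍ a in ν.ball x r, u a) (𝓝[>] 0) (𝓝 (u x)) := by
  obtain ⟨c, hc, hvol⟩ := ν.exists_volume_ball_eq
  have hp0 : 0 < p := one_pos.trans hp
  -- Finite total energy makes the inner integral finite at almost every point. At such a point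
  -- Jensen gives a deviation of order `r^s`, so no differentiation theorem is needed.
  have hfin : ∀ᵐ y ∂volume,
      ∫⁻ x, ENNReal.ofReal (gagliardoKernel ν s p u (x, y)) ∂volume < ⊤ := by
    refine ae_lt_top' ?_ hu.2.ne
    exact (aemeasurable_gagliardoKernel hu.1.1).ennreal_ofReal.prod_swap.lintegral_prod_right'
  filter_upwards [hfin] with x hx
  set F := ∫⁻ y, ENNReal.ofReal (gagliardoKernel ν s p u (y, x)) ∂volume with hF
  set Q : ℝ := (𝔾.homDim : ℝ) with hQ
  have key : ∀ r, 0 < r → |(⨍ a in ν.ball x r, u a) - u x| ≤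
      (c⁻¹ * F.toReal) ^ (1 / p) * r ^ s := by
    intro r hr
    have : IsFiniteMeasure (volume.restrict (ν.ball x r)) := ⟨by simp [hvol x r hr]⟩
    have hix : Integrable u (volume.restrict (ν.ball x r)) := hu.integrableOn_ball hp x r
    have hpos : 0 < c * r ^ Q := by positivity
    have hmu : (volume.restrict (ν.ball x r)) Set.univ = ENNReal.ofReal (c * r ^ Q) := by
      rw [Measure.restrict_apply_univ, hvol x r hr]
    have h1 := ofReal_abs_average_rpow_le (μ := volume.restrict (ν.ball x r))
      (by simp [hmu, hpos]) (f := fun a => u a - u x) (hix.sub (integrable_const (u x))) hp.le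
    have h2 : ⨍ a in ν.ball x r, (u a - u x) = (⨍ a in ν.ball x r, u a) - u x := by
      simp only [average_eq]
      rw [integral_sub hix (integrable_const (u x)), integral_const, Measure.real, hmu,
        ENNReal.toReal_ofReal hpos.le]
      simp only [smul_eq_mul]
      field_simp
    have h3 : ∫⁻ a in ν.ball x r, ENNReal.ofReal (|u a - u x| ^ p) ≤
        ENNReal.ofReal (r ^ (Q + p * s)) * F := by
      rw [hF, ← lintegral_const_mul' _ _ (by simp)]
      refine (setLIntegral_mono_ae' (ν.measurableSet_ball x r)
        (ae_of_all _ ?_)).trans (setLIntegral_le_lintegral _ _)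
      intro a ha
      have ha' : ν.dist x a < r := ha
      rw [ν.dist_comm] at ha'
      exact ofReal_abs_sub_rpow_le hp0 hs ha'.le
    rw [h2, hmu] at h1
    have h4 := h1.trans (mul_le_mul_right h3 _)
    rw [← ENNReal.ofReal_toReal hx.ne, ← ENNReal.ofReal_inv_of_pos hpos,
      ← ENNReal.ofReal_mul (by positivity), ← ENNReal.ofReal_mul (by positivity),
      ENNReal.ofReal_le_ofReal_iff (by positivity)] at h4
    have h5 : (c * r ^ Q)⁻¹ * (r ^ (Q + p * s) * F.toReal) = c⁻¹ * F.toReal * r ^ (s * p) := by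
      rw [Real.rpow_add hr, mul_comm s p]
      have := Real.rpow_pos_of_pos hr Q
      field_simp
    rw [h5] at h4
    have h6 := Real.rpow_le_rpow (by positivity) h4 (z := 1 / p) (by positivity)
    rwa [← Real.rpow_mul (abs_nonneg _), mul_one_div_cancel hp0.ne', Real.rpow_one,
      Real.mul_rpow (by positivity) (by positivity), ← Real.rpow_mul hr.le, mul_assoc s,
      mul_one_div_cancel hp0.ne', mul_one] at h6
  rw [tendsto_iff_dist_tendsto_zero]
  refine squeeze_zero' (Eventually.of_forall fun _ => dist_nonneg)
    (eventually_mem_nhdsWithin.mono fun r hr => key r hr) ?_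
  have h0 : Tendsto (fun r : ℝ => (c⁻¹ * F.toReal) ^ (1 / p) * r ^ s) (𝓝 0)
      (𝓝 ((c⁻¹ * F.toReal) ^ (1 / p) * 0 ^ s)) :=
    ((Real.continuous_rpow_const hs.le).tendsto 0).const_mul _
  rw [Real.zero_rpow hs.ne', mul_zero] at h0
  exact h0.mono_left nhdsWithin_le_nhds

/-- Morrey's inequality on a conull set. -/
theorem exists_morrey (ν : QuasiNorm 𝔾) (hp : 1 < p) (hs : 0 < s)
    (hsp : (𝔾.homDim : ℝ) < s * p) :
    ∃ C : ℝ, 0 ≤ C ∧ ∀ u : (Fin N → ℝ) → ℝ, MemW ν s p u → ∃ S : Set (Fin N → ℝ),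
      (∀ᵐ x ∂volume, x ∈ S) ∧ ∀ x ∈ S, ∀ y ∈ S,
        |u x - u y| ≤ C * normX₀ ν s p u * ν.dist x y ^ (s - 𝔾.homDim / p) := by
  obtain ⟨C, hC, hav⟩ := exists_abs_average_sub_average_le ν hp hs
  have hp0 : 0 < p := one_pos.trans hp
  set α : ℝ := s - 𝔾.homDim / p with hα
  have hα0 : 0 < α := by
    rw [hα, sub_pos, div_lt_iff₀ hp0]
    exact hsp
  set q : ℝ := (1 / 2) ^ α with hq
  have hq1 : q < 1 := Real.rpow_lt_one (by norm_num) (by norm_num) hα0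
  have hq0 : 0 < 1 - q := by linarith
  -- One geometric series for each of the two points, plus one comparison of the balls of radius
  -- `dist x y` around them.
  refine ⟨2 * (C / (1 - q)) + C, by positivity, fun u hu => ⟨_, hu.ae_tendsto_average hp hs, ?_⟩⟩
  have hM0 : 0 ≤ normX₀ ν s p u := by
    unfold normX₀
    positivity
  set M := normX₀ ν s p u with hM
  have hpt : ∀ x, Tendsto (fun r => ⨍ a in ν.ball x r, u a) (𝓝[>] 0) (𝓝 (u x)) →
      ∀ r, 0 < r → |(⨍ a in ν.ball x r, u a) - u x| ≤ C * M * r ^ α / (1 - q) := by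
    intro x hx r hr
    set f : ℕ → ℝ := fun n => ⨍ a in ν.ball x (r * (1 / 2) ^ n), u a with hf
    have hlim : Tendsto f atTop (𝓝 (u x)) := by
      refine hx.comp (tendsto_nhdsWithin_iff.mpr ⟨?_, Eventually.of_forall fun n => ?_⟩)
      · simpa using (tendsto_pow_atTop_nhds_zero_of_lt_one (r := (1 / 2 : ℝ))
          (by norm_num) (by norm_num)).const_mul r
      · exact Set.mem_Ioi.mpr (by positivity)
    -- Consecutive dyadic radii differ by exactly the factor 2 allowed in the comparison of
    -- averages; `α > 0` makes the telescoping series geometric.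
    have hstep : ∀ n, dist (f n) (f (n + 1)) ≤ C * M * r ^ α * q ^ n := by
      intro n
      have h := hav u hu x x (r * (1 / 2) ^ n) (r * (1 / 2) ^ (n + 1)) (by positivity)
        (le_of_eq (by ring)) (by rw [pow_succ]; nlinarith [pow_pos (one_half_pos (α := ℝ)) n])
        (by rw [ν.dist_self]; positivity)
      rw [Real.mul_rpow hr.le (by positivity), ← Real.rpow_natCast, ← Real.rpow_mul (by norm_num),
        mul_comm (n : ℝ), Real.rpow_mul (by norm_num), Real.rpow_natCast] at h
      rw [Real.dist_eq]
      refine h.trans_eq ?_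
      rw [Real.rpow_natCast, hM]
      ring
    have := dist_le_of_le_geometric_of_tendsto₀ q _ hq1 hstep hlim
    simpa [hf, Real.dist_eq] using this
  intro x hx y hy
  rcases (ν.dist_nonneg x y).eq_or_lt with h0 | h0
  · rw [ν.dist_eq_zero h0.symm, sub_self, abs_zero]
    have := ν.dist_nonneg y y
    positivity
  · have h1 := hpt x hx _ h0
    have h2 := hpt y hy _ h0
    have h3 := hav u hu x y _ _ h0 (by linarith) le_rfl le_rfl
    rw [abs_le] at h1 h2 h3 ⊢
    have : (2 * (C / (1 - q)) + C) * M * ν.dist x y ^ α =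
      2 * (C * M * ν.dist x y ^ α / (1 - q)) + C * M * ν.dist x y ^ α := by ring
    rw [this]
    constructor <;> linarith [h1.1, h1.2, h2.1, h2.2, h3.1, h3.2]

end

end Carnot

/-! ### Embedding into `L^∞` and compactness. -/

namespace Carnot

variable {N : ℕ} {𝔾 : StratifiedGroup N}

section

variable {ν : QuasiNorm 𝔾} {s p : ℝ} {Ω : Set (Fin N → ℝ)} {u v : (Fin N → ℝ) → ℝ}

theorem normX₀_nonneg : 0 ≤ normX₀ ν s p u := by
  unfold normX₀
  positivity

/-- The embedding of `X₀` into `L^∞`. -/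
theorem exists_abs_le_normX₀ (ν : QuasiNorm 𝔾) (hN : 0 < N) (hΩ : Bornology.IsBounded Ω)
    (hp : 1 < p) (hs : 0 < s) (hsp : (𝔾.homDim : ℝ) < s * p) :
    ∃ C : ℝ, 0 < C ∧ ∀ u : (Fin N → ℝ) → ℝ, MemX₀ ν s p Ω u →
      ∀ᵐ x ∂volume, |u x| ≤ C * normX₀ ν s p u := by
  obtain ⟨C, hC, hmor⟩ := exists_morrey ν hp hs hsp
  have hp0 : 0 < p := one_pos.trans hp
  have hα0 : 0 < s - 𝔾.homDim / p := by
    rw [sub_pos, div_lt_iff₀ hp0]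
    exact hsp
  obtain ⟨R, hR, hΩR⟩ := hΩ.subset_closedBall_lt 0 0
  obtain ⟨D, hD⟩ := ((ProperSpace.isCompact_closedBall (0 : Fin N → ℝ) (R + 2)).prod
    (ProperSpace.isCompact_closedBall (0 : Fin N → ℝ) (R + 2))).bddAbove_image
      ν.continuous_dist.continuousOn
  have hD' : ∀ x y : Fin N → ℝ, ‖x‖ ≤ R + 2 → ‖y‖ ≤ R + 2 → ν.dist x y ≤ D := fun x y hx hy =>
    hD ⟨(x, y), ⟨by simpa using hx, by simpa using hy⟩, rfl⟩
  have hD0 : 0 ≤ D := (ν.dist_nonneg 0 0).trans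
    (hD' 0 0 (by simp; linarith) (by simp; linarith))
  -- A nonempty open shell outside `Ω` meets the conull set where Morrey's inequality holds and `u`
  -- vanishes off `Ω`; comparison with a point there bounds `u`.
  set W : Set (Fin N → ℝ) := {x | R < ‖x‖ ∧ ‖x‖ < R + 2} with hW
  have hWo : IsOpen W := (isOpen_lt continuous_const continuous_norm).inter
    (isOpen_lt continuous_norm continuous_const)
  have hWne : W.Nonempty := by
    have : Nonempty (Fin N) := ⟨⟨0, hN⟩⟩
    refine ⟨fun _ => R + 1, ?_⟩
    have h : ‖(fun _ => R + 1 : Fin N → ℝ)‖ = R + 1 := by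
      rw [pi_norm_const, Real.norm_eq_abs, abs_of_pos (by linarith)]
    exact ⟨by rw [h]; linarith, by rw [h]; linarith⟩
  refine ⟨C * D ^ (s - 𝔾.homDim / p) + 1, by positivity, fun u hu => ?_⟩
  obtain ⟨S, hS, hSu⟩ := hmor u hu.1
  obtain ⟨z, ⟨hzS, hz0⟩, hzW⟩ := (Measure.dense_of_ae (hS.and hu.2)).exists_mem_open hWo hWne
  have hzΩ : z ∉ Ω := fun h => by
    have := hΩR h
    rw [mem_closedBall_zero_iff] at this
    exact absurd hzW.1 (not_lt.mpr this)
  filter_upwards [hS, hu.2] with x hxS hx0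
  have hn := normX₀_nonneg (ν := ν) (s := s) (p := p) (u := u)
  by_cases hx : x ∈ Ω
  · have h1 := hSu x hxS z hzS
    rw [hz0 hzΩ, sub_zero] at h1
    have h2 : ν.dist x z ^ (s - 𝔾.homDim / p) ≤ D ^ (s - 𝔾.homDim / p) := by
      have h3 := hΩR hx
      rw [mem_closedBall_zero_iff] at h3
      exact Real.rpow_le_rpow (ν.dist_nonneg _ _) (hD' x z (by linarith) hzW.2.le) hα0.le
    nlinarith [mul_le_mul_of_nonneg_left h2 (mul_nonneg hC hn)]
  · rw [hx0 hx, abs_zero]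
    positivity

/-- The compactness of the embedding of `X₀`: bounded sequences have almost everywhere convergent
subsequences. -/
theorem exists_subseq_tendsto_ae (ν : QuasiNorm 𝔾) (hN : 0 < N) (hΩ : Bornology.IsBounded Ω)
    (hp : 1 < p) (hs : 0 < s) (hsp : (𝔾.homDim : ℝ) < s * p) {u : ℕ → (Fin N → ℝ) → ℝ} {R : ℝ}
    (hu : ∀ n, MemX₀ ν s p Ω (u n)) (hR : ∀ n, normX₀ ν s p (u n) ≤ R) :
    ∃ φ : ℕ → ℕ, StrictMono φ ∧ ∃ v : (Fin N → ℝ) → ℝ,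
      ∀ᵐ x ∂volume, Tendsto (fun n => u (φ n) x) atTop (𝓝 (v x)) := by
  obtain ⟨C, hC, hmor⟩ := exists_morrey ν hp hs hsp
  obtain ⟨B, hB, hsup⟩ := exists_abs_le_normX₀ ν hN hΩ hp hs hsp
  have hp0 : 0 < p := one_pos.trans hp
  have hα0 : 0 < s - 𝔾.homDim / p := by
    rw [sub_pos, div_lt_iff₀ hp0]
    exact hsp
  choose S hS hSu using fun n => hmor (u n) (hu n).1
  set T : Set (Fin N → ℝ) := {x | ∀ n, x ∈ S n ∧ |u n x| ≤ B * R} with hT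
  have hTae : ∀ᵐ x ∂volume, x ∈ T := by
    refine ae_all_iff.mpr fun n => ?_
    filter_upwards [hS n, hsup (u n) (hu n)] with x h1 h2
    exact ⟨h1, h2.trans (mul_le_mul_of_nonneg_left (hR n) hB.le)⟩
  -- The dense set is taken inside the conull set `T`, so that Morrey's inequality holds at its
  -- points for all `n`. A countable product of intervals then yields one subsequence converging on
  -- all of it.
  obtain ⟨D, hDT, hDc, hDd⟩ := (Measure.dense_of_ae hTae).exists_countable_dense_subset
  have : Countable D := hDc.to_subtype
  have hK : IsCompact (Set.univ.pi fun _ : D => Set.Icc (-(B * R)) (B * R)) :=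
    isCompact_univ_pi fun _ => isCompact_Icc
  obtain ⟨a, -, φ, hφ, ha⟩ := hK.tendsto_subseq (x := fun n (d : D) => u n d)
    fun n d _ => abs_le.mp ((hDT d.2) n).2
  refine ⟨φ, hφ, ?_⟩
  -- As in Arzelà–Ascoli, the uniform Hölder bound carries the Cauchy property from nearby points of
  -- `D` to every point of `T`.
  have hlim : ∀ x ∈ T, ∃ l, Tendsto (fun n => u (φ n) x) atTop (𝓝 l) := by
    intro x hx
    refine cauchySeq_tendsto_of_complete (Metric.cauchySeq_iff'.mpr fun ε hε => ?_)
    have hcont : Continuous fun y => C * R * ν.dist x y ^ (s - 𝔾.homDim / p) :=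
      ((ν.continuous_dist.comp (by fun_prop : Continuous fun y => (x, y))).rpow_const
        fun _ => Or.inr hα0.le).const_mul _
    have hopen : IsOpen {y | C * R * ν.dist x y ^ (s - 𝔾.homDim / p) < ε / 4} :=
      isOpen_lt hcont continuous_const
    obtain ⟨y, hyD, hy⟩ := hDd.exists_mem_open hopen
      ⟨x, by
        show C * R * ν.dist x x ^ (s - 𝔾.homDim / p) < ε / 4
        rw [ν.dist_self, Real.zero_rpow hα0.ne', mul_zero]
        positivity⟩
    have hy' : C * R * ν.dist x y ^ (s - 𝔾.homDim / p) < ε / 4 := hy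
    have hclose : ∀ n, |u n x - u n y| < ε / 4 := fun n => by
      refine ((hSu n x (hx n).1 y ((hDT hyD) n).1).trans ?_).trans_lt hy'
      have := Real.rpow_nonneg (ν.dist_nonneg x y) (s - 𝔾.homDim / p)
      have := hR n
      gcongr
    have hyc : CauchySeq fun n => u (φ n) y :=
      ((tendsto_pi_nhds.mp ha) ⟨y, hyD⟩).cauchySeq
    obtain ⟨n₀, hn₀⟩ := Metric.cauchySeq_iff'.mp hyc (ε / 4) (by positivity)
    refine ⟨n₀, fun n hn => ?_⟩
    have h1 := hn₀ n hn
    have h2 := hclose (φ n)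
    have h3 := hclose (φ n₀)
    rw [Real.dist_eq, abs_lt] at h1 ⊢
    rw [abs_lt] at h2 h3
    constructor <;> linarith [h1.1, h1.2, h2.1, h2.2, h3.1, h3.2]
  choose! v hv using hlim
  exact ⟨v, hTae.mono hv⟩

end

end Carnot

/-! ### Integrals of powers of the quasi-norm, and cut-off functions in `X₀`. -/

namespace Carnot

variable {N : ℕ} {𝔾 : StratifiedGroup N}

namespace QuasiNorm

variable (ν : QuasiNorm 𝔾)

theorem measurable_nrm_rpow (a : ℝ) : Measurable fun h => ν.nrm h ^ a :=
  ν.continuous_nrm.measurable.pow_const a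

/-- Integrals of powers of the quasi-norm over annuli. -/
theorem exists_lintegral_annulus_le (a : ℝ) : ∃ M : ℝ, 0 ≤ M ∧ ∀ ρ : ℝ, 0 < ρ →
    ∫⁻ h in {h | ρ ≤ ν.nrm h ∧ ν.nrm h ≤ 2 * ρ}, ENNReal.ofReal (ν.nrm h ^ (a - 𝔾.homDim)) ≤
      ENNReal.ofReal (M * ρ ^ a) := by
  obtain ⟨c, hc, hvol⟩ := ν.exists_volume_ball_eq
  set Q : ℝ := (𝔾.homDim : ℝ) with hQ
  refine ⟨2 ^ |a - Q| * c * 4 ^ Q, by positivity, fun ρ hρ => ?_⟩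
  have hms : MeasurableSet {h | ρ ≤ ν.nrm h ∧ ν.nrm h ≤ 2 * ρ} :=
    ((isClosed_le continuous_const ν.continuous_nrm).inter
      (isClosed_le ν.continuous_nrm continuous_const)).measurableSet
  have h1 : ∀ h ∈ {h | ρ ≤ ν.nrm h ∧ ν.nrm h ≤ 2 * ρ}, ENNReal.ofReal (ν.nrm h ^ (a - Q)) ≤
      ENNReal.ofReal (2 ^ |a - Q| * ρ ^ (a - Q)) := by
    rintro h ⟨hh1, hh2⟩
    refine ENNReal.ofReal_le_ofReal ?_
    have e : ν.nrm h = ν.nrm h / ρ * ρ := by field_simp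
    have t1 : 1 ≤ ν.nrm h / ρ := by rwa [le_div_iff₀ hρ, one_mul]
    have t2 : ν.nrm h / ρ ≤ 2 := by rwa [div_le_iff₀ hρ]
    rw [e, Real.mul_rpow (by linarith) hρ.le]
    gcongr
    exact (Real.rpow_le_rpow_of_exponent_le t1 (le_abs_self _)).trans
      (Real.rpow_le_rpow (by linarith) t2 (abs_nonneg _))
  -- The volume formula is for open balls, so a radius larger than `2ρ` is used to contain the
  -- closed annulus.
  have h2 : volume {h | ρ ≤ ν.nrm h ∧ ν.nrm h ≤ 2 * ρ} ≤ ENNReal.ofReal (c * (4 * ρ) ^ Q) := by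
    rw [← hvol 0 (4 * ρ) (by positivity), ν.volume_ball]
    refine measure_mono fun h hh => show ν.nrm h < 4 * ρ from ?_
    have : ν.nrm h ≤ 2 * ρ := hh.2
    linarith
  calc _ ≤ ∫⁻ h in {h | ρ ≤ ν.nrm h ∧ ν.nrm h ≤ 2 * ρ},
        ENNReal.ofReal (2 ^ |a - Q| * ρ ^ (a - Q)) := setLIntegral_mono' hms h1
    _ ≤ ENNReal.ofReal (2 ^ |a - Q| * ρ ^ (a - Q)) * ENNReal.ofReal (c * (4 * ρ) ^ Q) := by
        rw [setLIntegral_const]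
        gcongr
    _ = _ := by
        rw [← ENNReal.ofReal_mul (by positivity), Real.mul_rpow (by norm_num) hρ.le,
          Real.rpow_sub hρ]
        congr 1
        have := Real.rpow_pos_of_pos hρ Q
        field_simp

/-- The dyadic annuli shrinking to the origin contribute a geometric series of ratio `2^(-γ)`. -/
theorem lintegral_nrm_rpow_le_one_lt_top {γ : ℝ} (hγ : 0 < γ) :
    ∫⁻ h in {h | 0 < ν.nrm h ∧ ν.nrm h ≤ 1}, ENNReal.ofReal (ν.nrm h ^ (γ - 𝔾.homDim)) < ⊤ := by
  obtain ⟨M, hM, h⟩ := ν.exists_lintegral_annulus_le γ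
  have hsub : {h | 0 < ν.nrm h ∧ ν.nrm h ≤ 1} ⊆ ⋃ n : ℕ,
      {h | (1 / 2 : ℝ) ^ (n + 1) ≤ ν.nrm h ∧ ν.nrm h ≤ 2 * (1 / 2 : ℝ) ^ (n + 1)} := by
    rintro x ⟨hx0, hx1⟩
    obtain ⟨n, hn1, hn2⟩ := exists_nat_pow_near_of_lt_one hx0 hx1
      (one_half_pos (α := ℝ)) one_half_lt_one
    refine Set.mem_iUnion.mpr ⟨n, hn1.le, hn2.trans (le_of_eq (by ring))⟩
  refine (lintegral_mono_set hsub).trans_lt ((lintegral_iUnion_le _ _).trans_lt ?_)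
  refine (ENNReal.tsum_le_tsum fun n => h _ (by positivity)).trans_lt ?_
  refine Summable.tsum_ofReal_lt_top (Summable.mul_left _ ?_)
  have hq : (1 / 2 : ℝ) ^ γ < 1 := Real.rpow_lt_one (by norm_num) (by norm_num) hγ
  refine (((summable_geometric_of_lt_one (by positivity) hq).mul_left ((1 / 2 : ℝ) ^ γ)).congr
    fun n => ?_)
  rw [← Real.rpow_natCast (1 / 2) (n + 1), ← Real.rpow_mul (by norm_num), mul_comm _ γ,
    Real.rpow_mul (by norm_num), Real.rpow_natCast, pow_succ, mul_comm]

theorem lintegral_nrm_rpow_one_lt_lt_top {γ : ℝ} (hγ : 0 < γ) :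
    ∫⁻ h in {h | 1 < ν.nrm h}, ENNReal.ofReal (ν.nrm h ^ (-γ - 𝔾.homDim)) < ⊤ := by
  obtain ⟨M, hM, h⟩ := ν.exists_lintegral_annulus_le (-γ)
  have hsub : {h | 1 < ν.nrm h} ⊆ ⋃ n : ℕ,
      {h | (2 : ℝ) ^ n ≤ ν.nrm h ∧ ν.nrm h ≤ 2 * (2 : ℝ) ^ n} := by
    intro x hx
    have hx1 : 1 < ν.nrm x := hx
    obtain ⟨n, hn1, hn2⟩ := exists_nat_pow_near hx1.le (one_lt_two (α := ℝ))
    refine Set.mem_iUnion.mpr ⟨n, hn1, hn2.le.trans (le_of_eq (by ring))⟩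
  refine (lintegral_mono_set hsub).trans_lt ((lintegral_iUnion_le _ _).trans_lt ?_)
  refine (ENNReal.tsum_le_tsum fun n => h _ (by positivity)).trans_lt ?_
  refine Summable.tsum_ofReal_lt_top (Summable.mul_left _ ?_)
  have hq : (2 : ℝ) ^ (-γ) < 1 := Real.rpow_lt_one_of_one_lt_of_neg one_lt_two (by linarith)
  refine ((summable_geometric_of_lt_one (by positivity) hq).congr fun n => ?_)
  rw [← Real.rpow_natCast 2 n, ← Real.rpow_mul (by norm_num), mul_comm _ (-γ),
    Real.rpow_mul (by norm_num), Real.rpow_natCast]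

/-- The Euclidean norm is controlled by the quasi-norm near the origin. -/
theorem exists_norm_le_nrm : ∃ L : ℝ, 0 ≤ L ∧ ∀ h, ν.nrm h ≤ 1 → ‖h‖ ≤ L * ν.nrm h := by
  obtain ⟨L, hL, hb⟩ := (ν.isCompact_closedBall 1).isBounded.exists_pos_norm_le
  refine ⟨L, hL.le, fun h hh => ?_⟩
  rcases (ν.nonneg h).eq_or_lt with h0 | h0
  · rw [(ν.eq_zero_iff h).mp h0.symm, norm_zero, (ν.eq_zero_iff 0).mpr rfl, mul_zero]
  set t := ν.nrm h with ht
  have h1 : ‖dilation 𝔾.weight t⁻¹ h‖ ≤ L := hb _ (by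
    show ν.nrm _ ≤ 1
    rw [ν.nrm_dilation _ (inv_pos.mpr h0), ← ht, inv_mul_cancel₀ h0.ne'])
  refine (pi_norm_le_iff_of_nonneg (by positivity)).mpr fun i => ?_
  have h2 := (norm_le_pi_norm _ i).trans h1
  -- Rescaling to quasi-norm 1 bounds the second factor, and `t^(weight i) ≤ t` because `t ≤ 1` and
  -- the weights are at least 1.
  have h3 : h i = t ^ 𝔾.weight i * dilation 𝔾.weight t⁻¹ h i :=
    (congrFun (𝔾.dilation_dilation_inv h0.ne' h) i).symm
  have h4 : t ^ 𝔾.weight i ≤ t := by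
    simpa using pow_le_pow_of_le_one h0.le hh (𝔾.weight_pos i)
  rw [h3, norm_mul, Real.norm_of_nonneg (by positivity), mul_comm L]
  gcongr

/-- The mean value inequality for the smooth group law between `(y, 0)` and `(y, h)`, inside a
compact ball where its derivative is bounded. -/
theorem exists_norm_mul_sub_le (R : ℝ) : ∃ L : ℝ, 0 ≤ L ∧ ∀ y h : Fin N → ℝ, ‖y‖ ≤ R →
    ν.nrm h ≤ 1 → ‖𝔾.mul y h - y‖ ≤ L * ν.nrm h := by
  obtain ⟨L₁, hL₁, h1⟩ := ν.exists_norm_le_nrm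
  set K := Metric.closedBall (0 : (Fin N → ℝ) × (Fin N → ℝ)) (max R L₁) with hK
  obtain ⟨L₂, hL₂⟩ := (ProperSpace.isCompact_closedBall (0 : (Fin N → ℝ) × (Fin N → ℝ))
    (max R L₁)).bddAbove_image
    (𝔾.contDiff_mul.continuous_fderiv (by simp)).norm.continuousOn
  refine ⟨max L₂ 0 * L₁, by positivity, fun y h hy hh => ?_⟩
  have hn := h1 h hh
  have hy' : (y, h) ∈ K := by
    rw [hK, mem_closedBall_zero_iff, Prod.norm_def]
    refine max_le_max hy (hn.trans ?_)
    nlinarith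
  have hy0 : (y, (0 : Fin N → ℝ)) ∈ K := by
    rw [hK, mem_closedBall_zero_iff, Prod.norm_def]
    exact max_le_max hy (by simpa using hL₁)
  have h2 := (convex_closedBall _ _).norm_image_sub_le_of_norm_fderiv_le (𝕜 := ℝ)
    (f := fun z : (Fin N → ℝ) × (Fin N → ℝ) => 𝔾.mul z.1 z.2) (C := max L₂ 0)
    (fun z _ => 𝔾.contDiff_mul.differentiable (by simp) z)
    (fun z hz => (hL₂ ⟨z, hz, rfl⟩).trans (le_max_left _ _)) hy0 hy'
  simp only [𝔾.mul_zero, Prod.mk_sub_mk, sub_self, sub_zero, Prod.norm_mk, norm_zero] at h2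
  rw [max_eq_right (norm_nonneg _)] at h2
  rw [mul_assoc]
  exact h2.trans (mul_le_mul_of_nonneg_left hn (le_max_right _ _))

end QuasiNorm

section

variable {ν : QuasiNorm 𝔾} {s p : ℝ} {Ω : Set (Fin N → ℝ)} {u v : (Fin N → ℝ) → ℝ}

theorem gagliardoKernel_swap (x y : Fin N → ℝ) :
    gagliardoKernel ν s p u (x, y) = gagliardoKernel ν s p u (y, x) := by
  simp only [gagliardoKernel]
  rw [abs_sub_comm, ν.dist_comm]

/-- With `h = y⁻¹x`, the Lipschitz bound controls the kernel by `|h|^(p - ps - Q)` near the origin,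
integrable because `s < 1`; boundedness gives `|h|^(-ps - Q)` far away, integrable because `s > 0`.
Left-invariance makes the inner integral independent of `y`. -/
theorem gagliardoEnergy_lt_top_of_lipschitz (hs₀ : 0 < s) (hs₁ : s < 1) (hp : 1 < p)
    {w : (Fin N → ℝ) → ℝ} {L R : ℝ} (hw0 : ∀ x, 0 ≤ w x) (hw1 : ∀ x, w x ≤ 1)
    (hL : ∀ x y, |w x - w y| ≤ L * ‖x - y‖) (hR : ∀ x, R < ‖x‖ → w x = 0) :
    gagliardoEnergy ν s p w < ⊤ := by
  have hp0 : 0 < p := one_pos.trans hp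
  obtain ⟨C, hC, hmul⟩ := ν.exists_norm_mul_sub_le R
  set Q : ℝ := (𝔾.homDim : ℝ) with hQ
  set A : Set (Fin N → ℝ) := {h | 0 < ν.nrm h ∧ ν.nrm h ≤ 1} with hA
  set A' : Set (Fin N → ℝ) := {h | 1 < ν.nrm h} with hA'
  have hAm : MeasurableSet A := ((isOpen_lt continuous_const ν.continuous_nrm).measurableSet).inter
      (isClosed_le ν.continuous_nrm continuous_const).measurableSet
  have hA'm : MeasurableSet A' := (isOpen_lt continuous_const ν.continuous_nrm).measurableSet
  set J : (Fin N → ℝ) → ℝ≥0∞ := fun h =>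
    A.indicator (fun h => ENNReal.ofReal ((|L| * C) ^ p) *
      ENNReal.ofReal (ν.nrm h ^ (p - p * s - Q))) h +
    A'.indicator (fun h => ENNReal.ofReal (ν.nrm h ^ (-(p * s) - Q))) h with hJ
  have hm1 : Measurable (A.indicator fun h => ENNReal.ofReal ((|L| * C) ^ p) *
      ENNReal.ofReal (ν.nrm h ^ (p - p * s - Q))) :=
    ((ν.measurable_nrm_rpow _).ennreal_ofReal.const_mul _).indicator hAm
  have hJm : Measurable J :=
    hm1.add ((ν.measurable_nrm_rpow _).ennreal_ofReal.indicator hA'm)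
  have hJfin : ∫⁻ h, J h < ⊤ := by
    rw [hJ, lintegral_add_left hm1, lintegral_indicator hAm, lintegral_indicator hA'm,
      lintegral_const_mul' _ _ (by simp)]
    exact ENNReal.add_lt_top.mpr ⟨ENNReal.mul_lt_top (by simp)
      (ν.lintegral_nrm_rpow_le_one_lt_top (by nlinarith)),
      ν.lintegral_nrm_rpow_one_lt_lt_top (by positivity)⟩
  have hloc : ∀ x y, ‖y‖ ≤ R →
      ENNReal.ofReal (gagliardoKernel ν s p w (x, y)) ≤ J (𝔾.mul (𝔾.inv y) x) := by
    intro x y hy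
    set h := 𝔾.mul (𝔾.inv y) x with hh
    have hx : x = 𝔾.mul y h := by rw [hh, 𝔾.mul_inv_cancel_left]
    have hd : ν.dist x y = ν.nrm h := rfl
    simp only [gagliardoKernel, hd]
    rcases (ν.nonneg h).eq_or_lt with h0 | h0
    · have : x = y := ν.dist_eq_zero (hd.trans h0.symm)
      rw [this, sub_self, abs_zero, Real.zero_rpow hp0.ne', zero_div]
      simp
    rcases le_or_gt (ν.nrm h) 1 with h1 | h1
    · refine le_trans ?_ le_self_add
      rw [Set.indicator_of_mem (show h ∈ A from ⟨h0, h1⟩), ← ENNReal.ofReal_mul (by positivity)]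
      refine ENNReal.ofReal_le_ofReal ?_
      have h2 : |w x - w y| ≤ |L| * C * ν.nrm h := by
        have := hmul y h hy h1
        rw [← hx] at this
        calc _ ≤ L * ‖x - y‖ := hL x y
          _ ≤ |L| * ‖x - y‖ := by gcongr; exact le_abs_self L
          _ ≤ |L| * (C * ν.nrm h) := by gcongr
          _ = _ := by ring
      have h3 := Real.rpow_le_rpow (abs_nonneg _) h2 hp0.le
      rw [Real.mul_rpow (by positivity) h0.le] at h3
      rw [div_le_iff₀ (by positivity), mul_assoc, ← Real.rpow_add h0]
      rwa [show p - p * s - Q + (Q + p * s) = p by ring]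
    · refine le_trans ?_ le_add_self
      rw [Set.indicator_of_mem (show h ∈ A' from h1)]
      refine ENNReal.ofReal_le_ofReal ?_
      rw [div_le_iff₀ (by positivity), ← Real.rpow_add h0,
        show -(p * s) - Q + (Q + p * s) = 0 by ring, Real.rpow_zero]
      refine Real.rpow_le_one (abs_nonneg _) ?_ hp0.le
      rw [abs_le]
      constructor <;> linarith [hw0 x, hw0 y, hw1 x, hw1 y]
  set B : Set (Fin N → ℝ) := Metric.closedBall 0 R with hB
  have hBm : MeasurableSet B := Metric.isClosed_closedBall.measurableSet
  set T : (Fin N → ℝ) → (Fin N → ℝ) → ℝ≥0∞ := fun y x =>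
    B.indicator (fun _ => J (𝔾.mul (𝔾.inv y) x)) y with hT
  have hTm : Measurable (Function.uncurry T) := by
    have h1 : Measurable fun z : (Fin N → ℝ) × (Fin N → ℝ) => J (𝔾.mul (𝔾.inv z.1) z.2) :=
      hJm.comp (𝔾.continuous_mul.comp
        ((𝔾.continuous_inv.comp continuous_fst).prodMk continuous_snd)).measurable
    exact h1.indicator (measurable_fst hBm)
  have hTint : ∫⁻ y, ∫⁻ x, T y x < ⊤ := by
    have h1 : ∀ y, ∫⁻ x, T y x = B.indicator (fun _ => ∫⁻ h, J h) y := by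
      intro y
      by_cases hy : y ∈ B
      · simp only [hT, Set.indicator_of_mem hy]
        exact (𝔾.measurePreserving_mul_left (𝔾.inv y)).lintegral_comp hJm
      · simp [hT, Set.indicator_of_notMem hy]
    simp only [h1]
    rw [lintegral_indicator hBm, setLIntegral_const]
    exact ENNReal.mul_lt_top hJfin (ProperSpace.isCompact_closedBall _ _).measure_lt_top
  -- The kernel vanishes unless one of the points lies in the ball containing the support; its
  -- symmetry covers both cases.
  have hdom : ∀ y x, ENNReal.ofReal (gagliardoKernel ν s p w (x, y)) ≤ T y x + T x y := by
    intro y x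
    by_cases hy : ‖y‖ ≤ R
    · refine le_trans ?_ le_self_add
      simp only [hT]
      rw [Set.indicator_of_mem (by simpa [hB] using hy)]
      exact hloc x y hy
    by_cases hx : ‖x‖ ≤ R
    · refine le_trans ?_ le_add_self
      simp only [hT]
      rw [Set.indicator_of_mem (by simpa [hB] using hx), gagliardoKernel_swap]
      exact hloc y x hx
    · rw [gagliardoKernel, hR x (not_le.mp hx), hR y (not_le.mp hy), sub_self, abs_zero,
        Real.zero_rpow hp0.ne', zero_div, ENNReal.ofReal_zero]
      exact zero_le
  calc gagliardoEnergy ν s p w ≤ ∫⁻ y, ∫⁻ x, (T y x + T x y) :=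
        lintegral_mono fun y => lintegral_mono fun x => hdom y x
    _ = ∫⁻ y, ((∫⁻ x, T y x) + ∫⁻ x, T x y) :=
        lintegral_congr fun y => lintegral_add_left (hTm.comp measurable_prodMk_left) _
    _ = (∫⁻ y, ∫⁻ x, T y x) + ∫⁻ y, ∫⁻ x, T x y :=
        lintegral_add_left hTm.lintegral_prod_right' _
    _ = (∫⁻ y, ∫⁻ x, T y x) + ∫⁻ y, ∫⁻ x, T y x := by
        rw [lintegral_lintegral_swap (f := fun y x => T x y)
          (hTm.comp measurable_swap).aemeasurable]
    _ < ⊤ := ENNReal.add_lt_top.mpr ⟨hTint, hTint⟩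

/-- Cut-off functions in `X₀`. -/
theorem exists_cutoff (ν : QuasiNorm 𝔾) (hs₀ : 0 < s) (hs₁ : s < 1) (hp : 1 < p)
    (hΩ : IsOpen Ω) (hne : Ω.Nonempty) :
    ∃ w : (Fin N → ℝ) → ℝ, MemX₀ ν s p Ω w ∧ (∀ x, 0 ≤ w x) ∧ (∀ x, w x ≤ 1) ∧
      ∃ V ⊆ Ω, IsOpen V ∧ V.Nonempty ∧ ∀ x ∈ V, w x = 1 := by
  obtain ⟨x₀, hx₀⟩ := hne
  obtain ⟨r', hr', hsub'⟩ := Metric.isOpen_iff.mp hΩ x₀ hx₀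
  obtain ⟨r, hr, rfl⟩ : ∃ r : ℝ, 0 < r ∧ r' = 2 * r := ⟨r' / 2, by positivity, by ring⟩
  set w : (Fin N → ℝ) → ℝ := fun x => max 0 (min 1 (2 - r⁻¹ * ‖x - x₀‖)) with hw
  have hwc : Continuous w := by fun_prop
  have hzero : ∀ x, x ∉ Metric.ball x₀ (2 * r) → w x = 0 := by
    intro x hx
    rw [Metric.mem_ball, dist_eq_norm, not_lt] at hx
    have h1 : 2 ≤ r⁻¹ * ‖x - x₀‖ := by
      rw [le_inv_mul_iff₀ hr]
      linarith
    exact max_eq_left ((min_le_right _ _).trans (by linarith))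
  have hw0 : ∀ x, 0 ≤ w x := fun x => le_max_left _ _
  have hw1 : ∀ x, w x ≤ 1 := fun x => max_le zero_le_one (min_le_left _ _)
  refine ⟨w, ⟨⟨?_, ?_⟩, ae_of_all _ fun x hx => hzero x fun h => hx (hsub' h)⟩, hw0, hw1,
    Metric.ball x₀ r, (Metric.ball_subset_ball (by linarith)).trans hsub', Metric.isOpen_ball,
    ⟨x₀, Metric.mem_ball_self hr⟩, fun x hx => ?_⟩
  · exact hwc.memLp_of_hasCompactSupport (HasCompactSupport.intro
      (ProperSpace.isCompact_closedBall x₀ (2 * r))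
      fun x hx => hzero x fun h => hx (Metric.ball_subset_closedBall h))
  · refine gagliardoEnergy_lt_top_of_lipschitz hs₀ hs₁ hp (L := r⁻¹) (R := ‖x₀‖ + 2 * r) hw0 hw1
      (fun x y => ?_) fun x hx => hzero x fun h => ?_
    · have h1 : |w x - w y| ≤ |(2 - r⁻¹ * ‖x - x₀‖) - (2 - r⁻¹ * ‖y - x₀‖)| := by
        have ha := abs_max_sub_max_le_max 0 (min 1 (2 - r⁻¹ * ‖x - x₀‖)) 0
          (min 1 (2 - r⁻¹ * ‖y - x₀‖))
        have hb := abs_min_sub_min_le_max 1 (2 - r⁻¹ * ‖x - x₀‖) 1 (2 - r⁻¹ * ‖y - x₀‖)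
        exact ha.trans (max_le (by simp) (hb.trans (max_le (by simp) le_rfl)))
      refine h1.trans ?_
      rw [show (2 - r⁻¹ * ‖x - x₀‖) - (2 - r⁻¹ * ‖y - x₀‖) = r⁻¹ * (‖y - x₀‖ - ‖x - x₀‖) by ring,
        abs_mul, abs_of_pos (inv_pos.mpr hr)]
      gcongr
      refine (abs_norm_sub_norm_le _ _).trans (le_of_eq ?_)
      rw [sub_sub_sub_cancel_right, norm_sub_rev]
    · rw [Metric.mem_ball, dist_eq_norm] at h
      linarith [norm_le_norm_add_norm_sub x₀ x, norm_sub_rev x x₀, norm_sub_norm_le x x₀]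
  · rw [Metric.mem_ball, dist_eq_norm] at hx
    have h1 : r⁻¹ * ‖x - x₀‖ ≤ 1 := by
      rw [inv_mul_le_iff₀ hr]
      linarith
    simp only [hw]
    rw [min_eq_left (by linarith), max_eq_right zero_le_one]

end

end Carnot

/-! ### Differentiability and semicontinuity of the energy and of the potential. -/

namespace Carnot

variable {N : ℕ} {𝔾 : StratifiedGroup N}

section Primitive

variable {g : ℝ → ℝ}

theorem hasDerivAt_primitive (hg : Continuous g) (t : ℝ) : HasDerivAt (primitive g) (g t) t :=
  intervalIntegral.integral_hasDerivAt_right (hg.intervalIntegrable _ _)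
    hg.stronglyMeasurable.stronglyMeasurableAtFilter hg.continuousAt

theorem continuous_primitive (hg : Continuous g) : Continuous (primitive g) :=
  continuous_iff_continuousAt.mpr fun t => (hasDerivAt_primitive hg t).continuousAt

theorem monotone_primitive (hg : Continuous g) (hg0 : ∀ t, 0 ≤ g t) : Monotone (primitive g) :=
  monotone_of_deriv_nonneg (fun t => (hasDerivAt_primitive hg t).differentiableAt)
    fun t => (hasDerivAt_primitive hg t).deriv ▸ hg0 t

theorem primitive_zero : primitive g 0 = 0 := by simp [primitive]

theorem primitive_nonneg (hg : Continuous g) (hg0 : ∀ t, 0 ≤ g t) {t : ℝ} (ht : 0 ≤ t) :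
    0 ≤ primitive g t :=
  (primitive_zero (g := g)).symm.le.trans (monotone_primitive hg hg0 ht)

theorem exists_abs_le_of_continuous {f : ℝ → ℝ} (hf : Continuous f) (b : ℝ) :
    ∃ M : ℝ, 0 ≤ M ∧ ∀ t, |t| ≤ b → |f t| ≤ M := by
  obtain ⟨M, hM⟩ := (isCompact_Icc (a := -b) (b := b)).exists_bound_of_continuousOn hf.continuousOn
  exact ⟨max M 0, le_max_right _ _, fun t ht => (hM t (abs_le.mp ht)).trans (le_max_left _ _)⟩

end Primitive

theorem abs_rpow_add_le {p : ℝ} (hp : 0 ≤ p) (a b : ℝ) :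
    (|a| + |b|) ^ p ≤ 2 ^ p * (|a| ^ p + |b| ^ p) := by
  have ha := abs_nonneg a
  have hb := abs_nonneg b
  have h1 : |a| + |b| ≤ 2 * max |a| |b| := by
    linarith [le_max_left |a| |b|, le_max_right |a| |b|]
  have h2 : (max |a| |b|) ^ p ≤ |a| ^ p + |b| ^ p := by
    have := Real.rpow_nonneg ha p
    have := Real.rpow_nonneg hb p
    rcases max_cases |a| |b| with h | h <;> rw [h.1] <;> linarith
  calc _ ≤ (2 * max |a| |b|) ^ p := by gcongr
    _ = 2 ^ p * (max |a| |b|) ^ p := Real.mul_rpow (by norm_num) (ha.trans (le_max_left _ _))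
    _ ≤ _ := by gcongr

/-- Used to dominate the derivative of the kernel. For `p < 2` the power `|x|^(p - 2)` is singular,
but multiplied by `|x|` it becomes `|x|^(p - 1)` with a positive exponent. -/
theorem abs_rpow_sub_two_mul_le {p : ℝ} (hp : 1 < p) {x b m : ℝ} (hx : |x| ≤ m) (hb : |b| ≤ m) :
    |(|x| ^ (p - 2) * x * b)| ≤ m ^ p := by
  have hm : 0 ≤ m := (abs_nonneg x).trans hx
  rw [abs_mul, abs_mul, abs_of_nonneg (Real.rpow_nonneg (abs_nonneg x) _)]
  rcases (abs_nonneg x).eq_or_lt with h0 | h0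
  · rw [← h0, mul_zero, zero_mul]
    positivity
  · have hm0 : 0 < m := h0.trans_le hx
    have h1 : |x| ^ (p - 2) * |x| = |x| ^ (p - 1) := by
      rw [← Real.rpow_add_one h0.ne']
      congr 1
      ring
    rw [h1]
    calc |x| ^ (p - 1) * |b| ≤ m ^ (p - 1) * m := by gcongr
      _ = m ^ p := by
        rw [← Real.rpow_add_one hm0.ne']
        congr 1
        ring

section

variable {ν : QuasiNorm 𝔾} {s p : ℝ} {Ω : Set (Fin N → ℝ)} {u v φ : (Fin N → ℝ) → ℝ}

theorem integrable_gagliardoKernel_iff (hu : AEStronglyMeasurable u volume) :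
    Integrable (gagliardoKernel ν s p u) (volume.prod volume) ↔ gagliardoEnergy ν s p u < ⊤ := by
  rw [lt_top_iff_ne_top, gagliardoEnergy_eq_lintegral_prod hu,
    lintegral_ofReal_ne_top_iff_integrable (aemeasurable_gagliardoKernel hu).aestronglyMeasurable
      (ae_of_all _ gagliardoKernel_nonneg)]

theorem toReal_gagliardoEnergy (hu : AEStronglyMeasurable u volume) :
    (gagliardoEnergy ν s p u).toReal =
      ∫ z, gagliardoKernel ν s p u z ∂(volume.prod volume) := by
  rw [gagliardoEnergy_eq_lintegral_prod hu, integral_eq_lintegral_of_nonneg_ae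
    (ae_of_all _ gagliardoKernel_nonneg) (aemeasurable_gagliardoKernel hu).aestronglyMeasurable]

theorem gagliardoKernel_add_smul_le (hp : 0 ≤ p) {t : ℝ} (ht : |t| ≤ 1)
    (z : (Fin N → ℝ) × (Fin N → ℝ)) :
    gagliardoKernel ν s p (fun x => u x + t * φ x) z ≤
      2 ^ p * (gagliardoKernel ν s p u z + gagliardoKernel ν s p φ z) := by
  simp only [gagliardoKernel]
  rw [← add_div, ← mul_div_assoc]
  have := ν.dist_nonneg z.1 z.2
  refine div_le_div_of_nonneg_right (le_trans ?_ (abs_rpow_add_le hp _ _)) (by positivity)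
  have h : u z.1 + t * φ z.1 - (u z.2 + t * φ z.2) = (u z.1 - u z.2) + t * (φ z.1 - φ z.2) := by
    ring
  rw [h]
  refine Real.rpow_le_rpow (abs_nonneg _) ((abs_add_le _ _).trans ?_) hp
  rw [abs_mul]
  have := abs_nonneg (φ z.1 - φ z.2)
  nlinarith

theorem MemW.add_smul (hp : 1 < p) (hu : MemW ν s p u) (hφ : MemW ν s p φ) {t : ℝ}
    (ht : |t| ≤ 1) : MemW ν s p fun x => u x + t * φ x := by
  have hL : MemLp (fun x => u x + t * φ x) (ENNReal.ofReal p) volume := hu.1.add (hφ.1.const_mul t)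
  refine ⟨hL, (integrable_gagliardoKernel_iff hL.1).mp ?_⟩
  refine Integrable.mono' ((((integrable_gagliardoKernel_iff hu.1.1).mpr hu.2).add
    ((integrable_gagliardoKernel_iff hφ.1.1).mpr hφ.2)).const_mul (2 ^ p))
    (aemeasurable_gagliardoKernel hL.1).aestronglyMeasurable (ae_of_all _ fun z => ?_)
  rw [Real.norm_of_nonneg (gagliardoKernel_nonneg z)]
  exact gagliardoKernel_add_smul_le (by linarith) ht z

theorem MemX₀.add_smul (hp : 1 < p) (hu : MemX₀ ν s p Ω u) (hφ : MemX₀ ν s p Ω φ) {t : ℝ}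
    (ht : |t| ≤ 1) : MemX₀ ν s p Ω fun x => u x + t * φ x := by
  refine ⟨hu.1.add_smul hp hφ.1 ht, ?_⟩
  filter_upwards [hu.2, hφ.2] with x h1 h2 hx
  rw [h1 hx, h2 hx, mul_zero, add_zero]

theorem gagliardoEnergy_const_mul {t : ℝ} (ht : 0 ≤ t) :
    gagliardoEnergy ν s p (fun x => t * u x) =
      ENNReal.ofReal (t ^ p) * gagliardoEnergy ν s p u := by
  unfold gagliardoEnergy
  rw [← lintegral_const_mul' _ _ (by simp)]
  refine lintegral_congr fun y => ?_
  rw [← lintegral_const_mul' _ _ (by simp)]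
  refine lintegral_congr fun x => ?_
  rw [← ENNReal.ofReal_mul (by positivity), ← mul_sub, abs_mul, abs_of_nonneg ht,
    Real.mul_rpow ht (abs_nonneg _), mul_div_assoc]

theorem MemX₀.const_mul (hu : MemX₀ ν s p Ω u) {t : ℝ} (ht : 0 ≤ t) :
    MemX₀ ν s p Ω fun x => t * u x := by
  refine ⟨⟨hu.1.1.const_mul t, ?_⟩, hu.2.mono fun x h hx => by simp [h hx]⟩
  rw [gagliardoEnergy_const_mul ht]
  exact ENNReal.mul_lt_top (by simp) hu.1.2

theorem gagliardoEnergy_abs_le (hp : 0 ≤ p) :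
    gagliardoEnergy ν s p (fun x => |u x|) ≤ gagliardoEnergy ν s p u := by
  refine lintegral_mono fun y => lintegral_mono fun x => ENNReal.ofReal_le_ofReal ?_
  have := ν.dist_nonneg x y
  refine div_le_div_of_nonneg_right (Real.rpow_le_rpow (abs_nonneg _) ?_ hp) (by positivity)
  exact abs_abs_sub_abs_le_abs_sub _ _

theorem MemX₀.abs (hp : 1 < p) (hu : MemX₀ ν s p Ω u) : MemX₀ ν s p Ω fun x => |u x| :=
  ⟨⟨hu.1.1.abs, (gagliardoEnergy_abs_le (by linarith)).trans_lt hu.1.2⟩,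
    hu.2.mono fun x h hx => by simp [h hx]⟩

theorem gagliardoEnergy_zero (hp : 0 < p) : gagliardoEnergy ν s p 0 = 0 := by
  simp [gagliardoEnergy, Real.zero_rpow hp.ne']

theorem memX₀_zero (hp : 0 < p) : MemX₀ ν s p Ω 0 :=
  ⟨⟨MemLp.zero, by simp [gagliardoEnergy_zero hp]⟩, ae_of_all _ fun _ _ => rfl⟩

/-- Differentiability of the Gagliardo energy along lines. -/
theorem hasDerivAt_gagliardoEnergy (hp : 1 < p) (hu : MemW ν s p u) (hφ : MemW ν s p φ) :
    Integrable (weakKernel ν s p u φ) (volume.prod volume) ∧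
      HasDerivAt (fun t => (gagliardoEnergy ν s p fun x => u x + t * φ x).toReal)
        (p * ∫ z, weakKernel ν s p u φ z ∂(volume.prod volume)) 0 := by
  have hp0 : 0 < p := one_pos.trans hp
  have hm : ∀ t, AEStronglyMeasurable (fun x => u x + t * φ x) volume := fun t =>
    hu.1.1.add (hφ.1.1.const_mul t)
  set F : ℝ → (Fin N → ℝ) × (Fin N → ℝ) → ℝ := fun t =>
    gagliardoKernel ν s p fun x => u x + t * φ x with hF
  set F' : ℝ → (Fin N → ℝ) × (Fin N → ℝ) → ℝ := fun t z =>
    p * weakKernel ν s p (fun x => u x + t * φ x) φ z with hF'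
  have hku := (integrable_gagliardoKernel_iff hu.1.1).mpr hu.2
  have hkφ := (integrable_gagliardoKernel_iff hφ.1.1).mpr hφ.2
  have hsub : ∀ t (z : (Fin N → ℝ) × (Fin N → ℝ)), u z.1 + t * φ z.1 - (u z.2 + t * φ z.2) =
      (u z.1 - u z.2) + t * (φ z.1 - φ z.2) := fun t z => by ring
  have hwm : AEStronglyMeasurable (F' 0) (volume.prod volume) := by
    have h1 : AEMeasurable (fun z : (Fin N → ℝ) × (Fin N → ℝ) => u z.1 + 0 * φ z.1)
      (volume.prod volume) := (hm 0).aemeasurable.comp_fst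
    have h2 : AEMeasurable (fun z : (Fin N → ℝ) × (Fin N → ℝ) => u z.2 + 0 * φ z.2)
      (volume.prod volume) := (hm 0).aemeasurable.comp_snd
    have h3 : AEMeasurable (fun z : (Fin N → ℝ) × (Fin N → ℝ) => φ z.1)
      (volume.prod volume) := hφ.1.1.aemeasurable.comp_fst
    have h4 : AEMeasurable (fun z : (Fin N → ℝ) × (Fin N → ℝ) => φ z.2)
      (volume.prod volume) := hφ.1.1.aemeasurable.comp_snd
    exact ((((((h1.sub h2).norm.pow_const (p - 2)).mul (h1.sub h2)).mul (h3.sub h4)).div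
      (measurable_dist_rpow ν _).aemeasurable).const_mul p).aestronglyMeasurable
  have hbound : ∀ z, ∀ t ∈ Metric.ball (0 : ℝ) 1, ‖F' t z‖ ≤
      p * (2 ^ p * (gagliardoKernel ν s p u z + gagliardoKernel ν s p φ z)) := by
    intro z t ht
    have ht' : |t| ≤ 1 := by simpa using (mem_ball_zero_iff.mp ht).le
    simp only [hF', weakKernel, gagliardoKernel]
    have hd := ν.dist_nonneg z.1 z.2
    rw [norm_mul, Real.norm_of_nonneg hp0.le, hsub, ← add_div, ← mul_div_assoc, norm_div,
      Real.norm_of_nonneg (Real.rpow_nonneg hd _), mul_comm s p, Real.norm_eq_abs]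
    refine mul_le_mul_of_nonneg_left (div_le_div_of_nonneg_right ?_ (by positivity)) hp0.le
    refine le_trans (abs_rpow_sub_two_mul_le hp ?_ ?_) (abs_rpow_add_le hp0.le _ _)
    · refine (abs_add_le _ _).trans ?_
      rw [abs_mul]
      have := abs_nonneg (φ z.1 - φ z.2)
      nlinarith
    · linarith [abs_nonneg (u z.1 - u z.2)]
  have hderiv : ∀ z, ∀ t ∈ Metric.ball (0 : ℝ) 1, HasDerivAt (fun t => F t z) (F' t z) t := by
    intro z t _
    have h1 : HasDerivAt (fun t => (u z.1 - u z.2) + t * (φ z.1 - φ z.2)) (φ z.1 - φ z.2) t := by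
      simpa using ((hasDerivAt_id t).mul_const (φ z.1 - φ z.2)).const_add (u z.1 - u z.2)
    have h2 := ((hasDerivAt_abs_rpow ((u z.1 - u z.2) + t * (φ z.1 - φ z.2)) hp).comp t h1).div_const
      (ν.dist z.1 z.2 ^ ((𝔾.homDim : ℝ) + p * s))
    have e1 : (fun t => F t z) = fun t => ((fun x : ℝ => |x| ^ p) ∘
        fun t => (u z.1 - u z.2) + t * (φ z.1 - φ z.2)) t /
          ν.dist z.1 z.2 ^ ((𝔾.homDim : ℝ) + p * s) := by
      funext t
      simp only [hF, gagliardoKernel, hsub, Function.comp_apply]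
    rw [e1]
    refine h2.congr_deriv ?_
    simp only [hF', weakKernel, hsub, mul_comm s p]
    ring
  have main := hasDerivAt_integral_of_dominated_loc_of_deriv_le (μ := volume.prod volume)
    (F := F) (F' := F') (x₀ := (0 : ℝ)) (Metric.ball_mem_nhds 0 one_pos)
    (Eventually.of_forall fun t => (aemeasurable_gagliardoKernel (hm t)).aestronglyMeasurable)
    (by simpa [hF] using hku) hwm (ae_of_all _ hbound) (((hku.add hkφ).const_mul _).const_mul _)
    (ae_of_all _ hderiv)
  have e0 : F' 0 = fun z => p * weakKernel ν s p u φ z := by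
    funext z
    simp [hF']
  rw [e0, integral_const_mul] at main
  refine ⟨?_, ?_⟩
  · have := main.1.const_mul p⁻¹
    simpa [← mul_assoc, inv_mul_cancel₀ hp0.ne'] using this
  · have e2 : (fun t => (gagliardoEnergy ν s p fun x => u x + t * φ x).toReal) =
        fun t => ∫ z, F t z ∂(volume.prod volume) := by
      funext t
      exact toReal_gagliardoEnergy (hm t)
    rw [e2]
    exact main.2

/-- Lower semicontinuity of the Gagliardo energy along almost everywhere convergent sequences. -/
theorem gagliardoEnergy_le_of_tendsto {w : ℕ → (Fin N → ℝ) → ℝ} {ℓ : ℝ} (hp : 0 ≤ p)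
    (hw : ∀ n, MemW ν s p (w n))
    (hv : ∀ᵐ x ∂volume, Tendsto (fun n => w n x) atTop (𝓝 (v x)))
    (hℓ : Tendsto (fun n => (gagliardoEnergy ν s p (w n)).toReal) atTop (𝓝 ℓ)) :
    gagliardoEnergy ν s p v ≤ ENNReal.ofReal ℓ := by
  have hvm : AEStronglyMeasurable v volume :=
    aestronglyMeasurable_of_tendsto_ae atTop (fun n => (hw n).1.1) hv
  have h1 : Tendsto (fun n => gagliardoEnergy ν s p (w n)) atTop (𝓝 (ENNReal.ofReal ℓ)) := by
    refine (ENNReal.tendsto_ofReal hℓ).congr fun n => ?_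
    exact ENNReal.ofReal_toReal (hw n).2.ne
  rw [← h1.liminf_eq, gagliardoEnergy_eq_lintegral_prod hvm]
  simp only [fun n => gagliardoEnergy_eq_lintegral_prod (ν := ν) (s := s) (p := p) (hw n).1.1]
  -- Fatou's lemma on the product space, where the kernels converge almost everywhere.
  refine le_trans (lintegral_mono_ae ?_) (lintegral_liminf_le' fun n =>
    (aemeasurable_gagliardoKernel (hw n).1.1).ennreal_ofReal)
  filter_upwards [Measure.quasiMeasurePreserving_fst.ae hv,
    Measure.quasiMeasurePreserving_snd.ae hv] with z hz1 hz2
  refine le_of_eq (Tendsto.liminf_eq ?_).symm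
  refine ENNReal.tendsto_ofReal (Tendsto.div_const ?_ _)
  exact ((Real.continuous_rpow_const hp).tendsto _).comp (hz1.sub hz2).abs

end

/-- The potential term `∫_Ω β G(u)`. -/
noncomputable def potential (Ω : Set (Fin N → ℝ)) (β : (Fin N → ℝ) → ℝ) (g : ℝ → ℝ)
    (u : (Fin N → ℝ) → ℝ) : ℝ :=
  ∫ x in Ω, β x * primitive g (u x)

section Potential

variable {Ω : Set (Fin N → ℝ)} {β u φ : (Fin N → ℝ) → ℝ} {g : ℝ → ℝ} {b : ℝ}

theorem integrableOn_mul_comp (hβ : IntegrableOn β Ω) {f : ℝ → ℝ} (hf : Continuous f)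
    (hum : AEStronglyMeasurable u volume) (hu : ∀ᵐ x ∂volume, |u x| ≤ b) :
    IntegrableOn (fun x => β x * f (u x)) Ω := by
  obtain ⟨M, hM, hb⟩ := exists_abs_le_of_continuous hf b
  refine Integrable.mul_bdd (c := M) hβ (hf.comp_aestronglyMeasurable hum).restrict ?_
  exact ae_restrict_of_ae (hu.mono fun x hx => hb _ hx)

/-- Since `g ≥ 0`, the primitive is nondecreasing, so its value at the sup bound `b` controls the
whole integrand. -/
theorem potential_le (hβ : IntegrableOn β Ω) (hβ0 : ∀ᵐ x ∂(volume.restrict Ω), 0 ≤ β x)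
    (hg : Continuous g) (hg0 : ∀ t, 0 ≤ g t)
    (hum : AEStronglyMeasurable u volume) (hu : ∀ᵐ x ∂volume, |u x| ≤ b) :
    potential Ω β g u ≤ (∫ x in Ω, β x) * primitive g b := by
  rw [potential, ← integral_mul_const]
  refine integral_mono_ae (integrableOn_mul_comp hβ (continuous_primitive hg) hum hu)
    (hβ.mul_const _) ?_
  filter_upwards [hβ0, ae_restrict_of_ae hu] with x h1 h2
  exact mul_le_mul_of_nonneg_left (monotone_primitive hg hg0 ((le_abs_self _).trans h2)) h1

theorem potential_le_abs (hβ : IntegrableOn β Ω) (hβ0 : ∀ᵐ x ∂(volume.restrict Ω), 0 ≤ β x)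
    (hg : Continuous g) (hg0 : ∀ t, 0 ≤ g t)
    (hum : AEStronglyMeasurable u volume) (hu : ∀ᵐ x ∂volume, |u x| ≤ b) :
    potential Ω β g u ≤ potential Ω β g fun x => |u x| := by
  refine integral_mono_ae (integrableOn_mul_comp hβ (continuous_primitive hg) hum hu)
    (integrableOn_mul_comp (b := b) hβ (continuous_primitive hg) hum.norm (by simpa using hu)) ?_
  filter_upwards [hβ0] with x h1
  exact mul_le_mul_of_nonneg_left (monotone_primitive hg hg0 (le_abs_self _)) h1

theorem tendsto_potential (hβ : IntegrableOn β Ω) (hg : Continuous g)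
    {w : ℕ → (Fin N → ℝ) → ℝ} (hwm : ∀ n, AEStronglyMeasurable (w n) volume)
    (hw : ∀ n, ∀ᵐ x ∂volume, |w n x| ≤ b)
    (hu : ∀ᵐ x ∂volume, Tendsto (fun n => w n x) atTop (𝓝 (u x))) :
    Tendsto (fun n => potential Ω β g (w n)) atTop (𝓝 (potential Ω β g u)) := by
  obtain ⟨M, hM, hb⟩ := exists_abs_le_of_continuous (continuous_primitive hg) b
  refine tendsto_integral_of_dominated_convergence (fun x => |β x| * M)
    (fun n => (integrableOn_mul_comp hβ (continuous_primitive hg) (hwm n) (hw n)).1)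
    (hβ.abs.mul_const M) (fun n => ?_) ?_
  · filter_upwards [ae_restrict_of_ae (hw n)] with x hx
    rw [norm_mul]
    exact mul_le_mul_of_nonneg_left (hb _ hx) (norm_nonneg _)
  · filter_upwards [ae_restrict_of_ae hu] with x hx
    exact (((continuous_primitive hg).tendsto _).comp hx).const_mul _

theorem hasDerivAt_potential (hβ : IntegrableOn β Ω) (hg : Continuous g)
    {b' : ℝ} (hum : AEStronglyMeasurable u volume) (hu : ∀ᵐ x ∂volume, |u x| ≤ b)
    (hφm : AEStronglyMeasurable φ volume) (hφ : ∀ᵐ x ∂volume, |φ x| ≤ b') :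
    IntegrableOn (fun x => β x * g (u x) * φ x) Ω ∧
      HasDerivAt (fun t => potential Ω β g fun x => u x + t * φ x)
        (∫ x in Ω, β x * g (u x) * φ x) 0 := by
  obtain ⟨M, hM, hMb⟩ := exists_abs_le_of_continuous hg (b + b')
  have hm : ∀ t, AEStronglyMeasurable (fun x => u x + t * φ x) volume := fun t =>
    hum.add (hφm.const_mul t)
  have main := hasDerivAt_integral_of_dominated_loc_of_deriv_le (μ := volume.restrict Ω)
    (F := fun t x => β x * primitive g (u x + t * φ x))
    (F' := fun t x => β x * g (u x + t * φ x) * φ x) (x₀ := (0 : ℝ))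
    (bound := fun x => |β x| * (M * b'))
    (Metric.ball_mem_nhds 0 one_pos)
    (Eventually.of_forall fun t => hβ.1.mul
      ((continuous_primitive hg).comp_aestronglyMeasurable (hm t)).restrict)
    (by simpa [IntegrableOn] using integrableOn_mul_comp hβ (continuous_primitive hg) hum hu)
    ((hβ.1.mul (hg.comp_aestronglyMeasurable (hm 0)).restrict).mul hφm.restrict)
    ?_ (hβ.abs.mul_const _) ?_
  · simpa [potential, IntegrableOn] using main
  · filter_upwards [ae_restrict_of_ae hu, ae_restrict_of_ae hφ] with x h1 h2 t ht
    have ht' : |t| ≤ 1 := by simpa using (mem_ball_zero_iff.mp ht).le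
    rw [norm_mul, norm_mul, mul_assoc]
    refine mul_le_mul_of_nonneg_left ?_ (norm_nonneg _)
    refine mul_le_mul (hMb _ ((abs_add_le _ _).trans ?_)) h2 (norm_nonneg _) hM
    rw [abs_mul]
    have := abs_nonneg (φ x)
    nlinarith
  · refine ae_of_all _ fun x t _ => ?_
    have h1 : HasDerivAt (fun t => u x + t * φ x) (φ x) t := by
      simpa using ((hasDerivAt_id t).mul_const (φ x)).const_add (u x)
    simpa [mul_assoc] using
      ((hasDerivAt_primitive hg (u x + t * φ x)).comp t h1).const_mul (β x)

end Potential

end Carnot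

/-! ### Minimisation on balls and existence of solutions. -/

namespace Carnot

variable {N : ℕ} {𝔾 : StratifiedGroup N}

/-- The energy functional of the problem. -/
noncomputable def energyFunctional (ν : QuasiNorm 𝔾) (s p : ℝ) (Ω : Set (Fin N → ℝ))
    (β : (Fin N → ℝ) → ℝ) (g : ℝ → ℝ) (lam : ℝ) (u : (Fin N → ℝ) → ℝ) : ℝ :=
  (gagliardoEnergy ν s p u).toReal / p - lam * potential Ω β g u

section

variable {ν : QuasiNorm 𝔾} {s p : ℝ} {Ω : Set (Fin N → ℝ)} {β u : (Fin N → ℝ) → ℝ} {g : ℝ → ℝ}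
  {lam C R : ℝ}

theorem normX₀_le_iff (hp : 0 < p) {a : ℝ} (ha : 0 ≤ a) :
    normX₀ ν s p u ≤ a ↔ (gagliardoEnergy ν s p u).toReal ≤ a ^ p := by
  rw [normX₀, one_div, Real.rpow_inv_le_iff_of_pos ENNReal.toReal_nonneg ha hp]

theorem neg_le_energyFunctional (hp : 0 < p) (hlam : 0 < lam) (hβ : IntegrableOn β Ω)
    (hβ0 : ∀ᵐ x ∂(volume.restrict Ω), 0 ≤ β x) (hg : Continuous g) (hg0 : ∀ t, 0 ≤ g t)
    {b : ℝ} (hum : AEStronglyMeasurable u volume) (hu : ∀ᵐ x ∂volume, |u x| ≤ b) :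
    -(lam * ((∫ x in Ω, β x) * primitive g b)) ≤ energyFunctional ν s p Ω β g lam u := by
  have h1 := mul_le_mul_of_nonneg_left (potential_le hβ hβ0 hg hg0 hum hu) hlam.le
  have h2 : 0 ≤ (gagliardoEnergy ν s p u).toReal / p := by positivity
  rw [energyFunctional]
  linarith

/-- The functional has a nonnegative minimiser on balls of `X₀`. -/
theorem exists_minimizer (hN : 0 < N) (hΩo : IsOpen Ω) (hΩ : Bornology.IsBounded Ω)
    (hp : 1 < p) (hs : 0 < s) (hsp : (𝔾.homDim : ℝ) < s * p) (hlam : 0 < lam)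
    (hβ : IntegrableOn β Ω)
    (hβ0 : ∀ᵐ x ∂(volume.restrict Ω), 0 ≤ β x) (hg : Continuous g) (hg0 : ∀ t, 0 ≤ g t)
    (hC : 0 < C) (hsup : ∀ u, MemX₀ ν s p Ω u → ∀ᵐ x ∂volume, |u x| ≤ C * normX₀ ν s p u)
    (hR : 0 ≤ R) :
    ∃ u, MemX₀ ν s p Ω u ∧ normX₀ ν s p u ≤ R ∧ (∀ x, 0 ≤ u x) ∧
      ∀ v, MemX₀ ν s p Ω v → normX₀ ν s p v ≤ R →
        energyFunctional ν s p Ω β g lam u ≤ energyFunctional ν s p Ω β g lam v := by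
  have hp0 : 0 < p := one_pos.trans hp
  have hbd : ∀ u, MemX₀ ν s p Ω u → normX₀ ν s p u ≤ R → ∀ᵐ x ∂volume, |u x| ≤ C * R :=
    fun u hu huR => (hsup u hu).mono fun x hx => hx.trans (mul_le_mul_of_nonneg_left huR hC.le)
  set E := energyFunctional ν s p Ω β g lam with hE
  set A : Set ℝ := E '' {u | MemX₀ ν s p Ω u ∧ normX₀ ν s p u ≤ R} with hA
  have hAne : A.Nonempty := ⟨E 0, 0, ⟨memX₀_zero hp0,
    (normX₀_le_iff hp0 hR).mpr (by simpa [gagliardoEnergy_zero hp0] using by positivity)⟩, rfl⟩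
  have hAb : BddBelow A := by
    refine ⟨-(lam * ((∫ x in Ω, β x) * primitive g (C * R))), ?_⟩
    rintro _ ⟨u, ⟨hu, huR⟩, rfl⟩
    exact neg_le_energyFunctional hp0 hlam hβ hβ0 hg hg0 hu.1.1.1 (hbd u hu huR)
  obtain ⟨a, -, ha, haA⟩ := exists_seq_tendsto_sInf hAne hAb
  choose w hw hwa using haA
  obtain ⟨φ, hφ, v, hv⟩ := exists_subseq_tendsto_ae ν hN hΩ hp hs hsp
    (fun n => (hw n).1) (fun n => (hw n).2)
  have hwb : ∀ n, ∀ᵐ x ∂volume, |w n x| ≤ C * R := fun n => hbd _ (hw n).1 (hw n).2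
  have hvm : AEStronglyMeasurable v volume :=
    aestronglyMeasurable_of_tendsto_ae atTop (fun n => (hw (φ n)).1.1.1.1) hv
  have hvb : ∀ᵐ x ∂volume, |v x| ≤ C * R := by
    filter_upwards [hv, ae_all_iff.mpr hwb] with x h1 h2
    exact le_of_tendsto' h1.abs fun n => h2 (φ n)
  have hv0 : ∀ᵐ x ∂volume, x ∉ Ω → v x = 0 := by
    filter_upwards [hv, ae_all_iff.mpr fun n => (hw n).1.2] with x h1 h2 hx
    refine tendsto_nhds_unique h1 (tendsto_const_nhds.congr fun n => ?_)
    exact (h2 (φ n) hx).symm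
  have hpot : Tendsto (fun n => potential Ω β g (w (φ n))) atTop (𝓝 (potential Ω β g v)) :=
    tendsto_potential hβ hg (fun n => (hw (φ n)).1.1.1.1) (fun n => hwb (φ n)) hv
  -- The values of the functional and the potentials converge, so the Gagliardo energies converge
  -- too; semicontinuity then applies with this explicit limit.
  have hΦ : Tendsto (fun n => (gagliardoEnergy ν s p (w (φ n))).toReal) atTop
      (𝓝 (p * (sInf A + lam * potential Ω β g v))) := by
    refine (((ha.comp hφ.tendsto_atTop).add (hpot.const_mul lam)).const_mul p).congr fun n => ?_
    simp only [Function.comp_apply]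
    rw [← hwa (φ n), hE, energyFunctional]
    field_simp
    ring
  have hle := gagliardoEnergy_le_of_tendsto hp0.le (fun n => (hw (φ n)).1.1) hv hΦ
  have hℓ0 : 0 ≤ p * (sInf A + lam * potential Ω β g v) :=
    ge_of_tendsto' hΦ fun n => ENNReal.toReal_nonneg
  have hle' : (gagliardoEnergy ν s p v).toReal ≤ p * (sInf A + lam * potential Ω β g v) :=
    ENNReal.toReal_le_of_le_ofReal hℓ0 hle
  have hvX : MemX₀ ν s p Ω v := by
    refine ⟨⟨?_, hle.trans_lt ENNReal.ofReal_lt_top⟩, hv0⟩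
    have : IsFiniteMeasure (volume.restrict Ω) := ⟨by simpa using hΩ.measure_lt_top⟩
    have h1 : MemLp v (ENNReal.ofReal p) (volume.restrict Ω) :=
      MemLp.of_bound hvm.restrict (C * R) (ae_restrict_of_ae hvb)
    refine ((memLp_indicator_iff_restrict hΩo.measurableSet).mpr h1).ae_eq ?_
    filter_upwards [hv0] with x hx
    by_cases h : x ∈ Ω
    · rw [Set.indicator_of_mem h]
    · rw [Set.indicator_of_notMem h, hx h]
  have hvR : normX₀ ν s p v ≤ R := by
    refine (normX₀_le_iff hp0 hR).mpr (hle'.trans (le_of_tendsto' hΦ fun n => ?_))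
    exact (normX₀_le_iff hp0 hR).mp (hw (φ n)).2
  have hEv : E v ≤ sInf A := by
    rw [hE, energyFunctional, sub_le_iff_le_add, div_le_iff₀ hp0]
    linarith
  have hval : (gagliardoEnergy ν s p fun x => |v x|).toReal ≤ (gagliardoEnergy ν s p v).toReal :=
    ENNReal.toReal_mono hvX.1.2.ne (gagliardoEnergy_abs_le hp0.le)
  refine ⟨fun x => |v x|, hvX.abs hp, ?_, fun x => abs_nonneg _, fun z hz hzR => ?_⟩
  · exact (normX₀_le_iff hp0 hR).mpr (hval.trans ((normX₀_le_iff hp0 hR).mp hvR))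
  · have h1 : E (fun x => |v x|) ≤ E v := by
      have h2 := mul_le_mul_of_nonneg_left
        (potential_le_abs hβ hβ0 hg hg0 hvm hvb) hlam.le
      have h3 := div_le_div_of_nonneg_right hval hp0.le
      rw [hE, energyFunctional, energyFunctional]
      linarith
    exact h1.trans (hEv.trans (csInf_le hAb ⟨z, ⟨hz, hzR⟩, rfl⟩))

/-- Minimisers in the interior of a ball satisfy the weak equation. -/
theorem weak_equation_of_minimizer (hp : 1 < p)
    (hβ : IntegrableOn β Ω) (hg : Continuous g)
    (hsup : ∀ u, MemX₀ ν s p Ω u → ∀ᵐ x ∂volume, |u x| ≤ C * normX₀ ν s p u)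
    (hu : MemX₀ ν s p Ω u) (huR : normX₀ ν s p u < R)
    (hmin : ∀ v, MemX₀ ν s p Ω v → normX₀ ν s p v ≤ R →
      energyFunctional ν s p Ω β g lam u ≤ energyFunctional ν s p Ω β g lam v)
    {φ : (Fin N → ℝ) → ℝ} (hφ : MemX₀ ν s p Ω φ) :
    Integrable (weakKernel ν s p u φ) (volume.prod volume) ∧
      IntegrableOn (fun x => β x * g (u x) * φ x) Ω volume ∧
      ∫ z, weakKernel ν s p u φ z ∂(volume.prod volume) =
        lam * ∫ x in Ω, β x * g (u x) * φ x := by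
  have hp0 : 0 < p := one_pos.trans hp
  obtain ⟨hi1, hd1⟩ := hasDerivAt_gagliardoEnergy hp hu.1 hφ.1
  obtain ⟨hi2, hd2⟩ := hasDerivAt_potential hβ hg hu.1.1.1 (hsup u hu) hφ.1.1.1 (hsup φ hφ)
  refine ⟨hi1, hi2, ?_⟩
  have hd := (hd1.div_const p).sub (hd2.const_mul lam)
  have e0 : (fun x => u x + 0 * φ x) = u := by
    funext x
    ring
  -- Continuity of the norm along the line keeps small perturbations inside the ball, so `t = 0` is
  -- an unconstrained local minimum.
  have hcont : Tendsto (fun t => normX₀ ν s p fun x => u x + t * φ x) (𝓝 0)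
      (𝓝 (normX₀ ν s p u)) := by
    have h1 := ((Real.continuous_rpow_const (one_div_pos.mpr hp0).le).tendsto _).comp
      hd1.continuousAt
    simp only [e0] at h1
    exact h1
  have hloc : IsLocalMin (fun t => energyFunctional ν s p Ω β g lam fun x => u x + t * φ x) 0 := by
    filter_upwards [hcont.eventually_lt_const huR, Metric.ball_mem_nhds (0 : ℝ) one_pos]
      with t ht1 ht2
    rw [e0]
    refine hmin _ (hu.add_smul hp hφ ?_) ht1.le
    simpa using (mem_ball_zero_iff.mp ht2).le
  have h0 := hloc.hasDerivAt_eq_zero hd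
  rw [mul_div_cancel_left₀ _ hp0.ne'] at h0
  linarith

/-- A function of negative energy in a ball on which the potential is small yields a solution. -/
theorem exists_solution (hN : 0 < N) (hΩo : IsOpen Ω) (hΩ : Bornology.IsBounded Ω)
    (hp : 1 < p) (hs : 0 < s) (hsp : (𝔾.homDim : ℝ) < s * p) (hlam : 0 < lam)
    (hβ : IntegrableOn β Ω)
    (hβ0 : ∀ᵐ x ∂(volume.restrict Ω), 0 ≤ β x) (hg : Continuous g) (hg0 : ∀ t, 0 ≤ g t)
    (hC : 0 < C) (hsup : ∀ u, MemX₀ ν s p Ω u → ∀ᵐ x ∂volume, |u x| ≤ C * normX₀ ν s p u)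
    {b : ℝ} (hb : 0 < b)
    (hsmall : p * lam * (∫ x in Ω, β x) * primitive g b < (b / C) ^ p)
    {w : (Fin N → ℝ) → ℝ} (hw : MemX₀ ν s p Ω w) (hwb : normX₀ ν s p w ≤ b / C)
    (hw0 : energyFunctional ν s p Ω β g lam w < 0) :
    ∃ u, IsWeakSolution ν s p Ω β g lam u ∧ (∀ x, 0 ≤ u x) ∧ normX₀ ν s p u ≤ b / C ∧
      energyFunctional ν s p Ω β g lam u ≤ energyFunctional ν s p Ω β g lam w := by
  have hp0 : 0 < p := one_pos.trans hp
  have hR : 0 ≤ b / C := by positivity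
  obtain ⟨u, hu, huR, hu0, hmin⟩ := exists_minimizer hN hΩo hΩ hp hs hsp hlam hβ hβ0 hg hg0 hC
    hsup hR
  have huw := hmin w hw hwb
  have hub : ∀ᵐ x ∂volume, |u x| ≤ b := (hsup u hu).mono fun x hx => by
    refine hx.trans ((mul_le_mul_of_nonneg_left huR hC.le).trans (le_of_eq ?_))
    field_simp
  have hneg := huw.trans_lt hw0
  -- On the sphere the energy term equals `(b / C)^p / p`, which exceeds the largest possible
  -- potential term by `hsmall`; this contradicts the negative value of the functional.
  have hint : normX₀ ν s p u < b / C := by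
    by_contra! h
    have h1 : (gagliardoEnergy ν s p u).toReal = (b / C) ^ p := by
      rw [← le_antisymm huR h, normX₀, ← Real.rpow_mul ENNReal.toReal_nonneg,
        one_div_mul_cancel hp0.ne', Real.rpow_one]
    have h2 := mul_le_mul_of_nonneg_left (potential_le hβ hβ0 hg hg0 hu.1.1.1 hub) hlam.le
    rw [energyFunctional, h1, sub_neg, div_lt_iff₀ hp0] at hneg
    nlinarith
  refine ⟨u, ⟨hu, fun h0 => ?_, fun φ hφ =>
    weak_equation_of_minimizer hp hβ hg hsup hu hint hmin hφ⟩, hu0, huR, huw⟩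
  have h1 : potential Ω β g u = 0 := by
    rw [potential]
    refine integral_eq_zero_of_ae ?_
    filter_upwards [ae_restrict_of_ae h0] with x hx
    rw [hx]
    simp [primitive_zero]
  rw [energyFunctional, h1, mul_zero, sub_zero] at hneg
  have : 0 ≤ (gagliardoEnergy ν s p u).toReal / p := by positivity
  linarith

theorem normX₀_const_mul (hp : 0 < p) {d : ℝ} (hd : 0 ≤ d) :
    normX₀ ν s p (fun x => d * u x) = d * normX₀ ν s p u := by
  rw [normX₀, gagliardoEnergy_const_mul hd, ENNReal.toReal_mul,
    ENNReal.toReal_ofReal (by positivity), Real.mul_rpow (by positivity) ENNReal.toReal_nonneg,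
    ← Real.rpow_mul hd, mul_one_div_cancel hp.ne', Real.rpow_one, normX₀]

/-- Multiples of a cut-off function have very negative energy where the primitive is large. -/
theorem exists_energyFunctional_lt (ν : QuasiNorm 𝔾) (hs₀ : 0 < s) (hs₁ : s < 1) (hp : 1 < p)
    (hΩo : IsOpen Ω) (hΩ : Bornology.IsBounded Ω) (hne : Ω.Nonempty) (hlam : 0 < lam)
    (hβ : IntegrableOn β Ω) {β₀ : ℝ} (hβ₀ : 0 < β₀)
    (hββ₀ : ∀ᵐ x ∂(volume.restrict Ω), β₀ ≤ β x) (hg : Continuous g) (hg0 : ∀ t, 0 ≤ g t) :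
    ∃ w, MemX₀ ν s p Ω w ∧ ∃ K : ℝ, ∀ d : ℝ, 0 < d → K < primitive g d / d ^ p →
      energyFunctional ν s p Ω β g lam (fun x => d * w x) < -d ^ p := by
  have hp0 : 0 < p := one_pos.trans hp
  obtain ⟨w, hw, hw0, hw1, V, hVΩ, hVo, hVne, hV⟩ := exists_cutoff ν hs₀ hs₁ hp hΩo hne
  have hVfin : volume V < ⊤ := (hΩ.subset hVΩ).measure_lt_top
  have hm : 0 < volume.real V := ENNReal.toReal_pos (hVo.measure_pos _ hVne).ne' hVfin.ne
  -- Above this threshold, the contribution of the set `V` where `w = 1` beats the Gagliardo term by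
  -- more than `d^p`. That margin makes the energies unbounded below in the case `M = +∞`.
  refine ⟨w, hw, ((gagliardoEnergy ν s p w).toReal / p + 1) / (lam * (β₀ * volume.real V)),
    fun d hd hK => ?_⟩
  have hdp : 0 < d ^ p := by positivity
  have hpot : β₀ * volume.real V * primitive g d ≤ potential Ω β g fun x => d * w x := by
    have hI : IntegrableOn (fun x => β x * primitive g (d * w x)) Ω :=
      integrableOn_mul_comp (b := d) hβ (continuous_primitive hg) (hw.1.1.1.const_mul d)
        (ae_of_all _ fun x => by
          rw [abs_of_nonneg (mul_nonneg hd.le (hw0 x))]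
          nlinarith [hw1 x])
    calc β₀ * volume.real V * primitive g d = ∫ _ in V, β₀ * primitive g d := by
          rw [setIntegral_const, smul_eq_mul]
          ring
      _ ≤ ∫ x in V, β x * primitive g (d * w x) := by
          refine integral_mono_ae (integrableOn_const hVfin.ne) (hI.mono_set hVΩ) ?_
          filter_upwards [ae_restrict_of_ae_restrict_of_subset hVΩ hββ₀,
            ae_restrict_mem hVo.measurableSet] with x h1 h2
          rw [hV x h2, mul_one]
          exact mul_le_mul_of_nonneg_right h1 (primitive_nonneg hg hg0 hd.le)
      _ ≤ _ := by
          refine setIntegral_mono_set hI ?_ (LE.le.eventuallyLE hVΩ)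
          filter_upwards [hββ₀] with x h1
          exact mul_nonneg (hβ₀.le.trans h1)
            (primitive_nonneg hg hg0 (mul_nonneg hd.le (hw0 x)))
  rw [energyFunctional, gagliardoEnergy_const_mul hd.le, ENNReal.toReal_mul,
    ENNReal.toReal_ofReal hdp.le]
  rw [div_lt_div_iff₀ (by positivity) hdp] at hK
  have h1 := mul_le_mul_of_nonneg_left hpot hlam.le
  have h2 : d ^ p * (gagliardoEnergy ν s p w).toReal / p =
    (gagliardoEnergy ν s p w).toReal / p * d ^ p := by ring
  nlinarith

end

/-! ### Use of the oscillation and construction of the two sequences. -/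

theorem Oscillates.frequently_lt {g : ℝ → ℝ} {p : ℝ} {l : Filter ℝ} (h : Oscillates g p l)
    {ε : ℝ} (hε : 0 < ε) : ∃ᶠ τ in l, primitive g τ / τ ^ p < ε := by
  have h1 : liminf (fun τ : ℝ => ((primitive g τ / τ ^ p : ℝ) : EReal)) l < (ε : EReal) := by
    rw [h.1]
    exact_mod_cast hε
  exact (frequently_lt_of_liminf_lt (by isBoundedDefault) h1).mono fun τ hτ => by
    exact_mod_cast hτ

theorem Oscillates.frequently_gt {g : ℝ → ℝ} {p : ℝ} {l : Filter ℝ} (h : Oscillates g p l)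
    (K : ℝ) : ∃ᶠ τ in l, K < primitive g τ / τ ^ p := by
  have h1 : (K : EReal) < limsup (fun τ : ℝ => ((primitive g τ / τ ^ p : ℝ) : EReal)) l := by
    rw [h.2]
    exact EReal.coe_lt_top K
  exact (frequently_lt_of_lt_limsup (by isBoundedDefault) h1).mono fun τ hτ => by
    exact_mod_cast hτ

/-- Smallness of the primitive along a sequence, in the form used in `exists_solution`. -/
theorem exists_small_primitive_bound {p C A : ℝ} (hC : 0 < C) (hA : 0 ≤ A) :
    ∃ ε : ℝ, 0 < ε ∧ ∀ b G : ℝ, 0 < b → 0 ≤ G → G / b ^ p < ε → A * G < (b / C) ^ p := by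
  -- The shift to `A + 1` keeps the denominator positive when `A = 0`.
  refine ⟨1 / (C ^ p * (A + 1)), by positivity, fun b G hb hG h => ?_⟩
  rw [div_lt_div_iff₀ (by positivity) (by positivity), one_mul] at h
  rw [Real.div_rpow hb.le hC.le, lt_div_iff₀ (by positivity)]
  have : 0 < C ^ p := by positivity
  nlinarith [mul_nonneg hG this.le]

end Carnot

theorem theorem1p6 {N : ℕ} (hN : 0 < N) (𝔾 : Carnot.StratifiedGroup N) (ν : Carnot.QuasiNorm 𝔾)
    (Ω : Set (Fin N → ℝ)) (hΩ_open : IsOpen Ω) (hΩ_bdd : Bornology.IsBounded Ω)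
    (hΩ_ne : Ω.Nonempty)
    (s p : ℝ) (hs₀ : 0 < s) (hs₁ : s < 1) (hp : 1 < p) (hsp : (𝔾.homDim : ℝ) < s * p)
    (β : (Fin N → ℝ) → ℝ) (hβ : MemLp β ⊤ (volume.restrict Ω))
    (hβ_pos : ∃ β₀ : ℝ, 0 < β₀ ∧ ∀ᵐ x ∂(volume.restrict Ω), β₀ ≤ β x)
    (g : ℝ → ℝ) (hg : Continuous g) (hg_nonneg : ∀ t, 0 ≤ g t) (hg_zero : g 0 = 0) :
    (Carnot.Oscillates g p atTop →
      ∀ lam : ℝ, 0 < lam → ∃ u : ℕ → (Fin N → ℝ) → ℝ,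
        (∀ n, Carnot.IsWeakSolution ν s p Ω β g lam (u n) ∧ ∀ᵐ x ∂volume, 0 ≤ u n x) ∧
        Tendsto (fun n => Carnot.normX₀ ν s p (u n)) atTop atTop) ∧
    (Carnot.Oscillates g p (𝓝[>] 0) →
      ∀ lam : ℝ, 0 < lam → ∃ u : ℕ → (Fin N → ℝ) → ℝ,
        (∀ n, Carnot.IsWeakSolution ν s p Ω β g lam (u n) ∧ ∀ᵐ x ∂volume, 0 ≤ u n x) ∧
        Tendsto (fun n => Carnot.normX₀ ν s p (u n)) atTop (𝓝 0) ∧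
        Tendsto (fun n => eLpNorm (u n) ⊤ (volume.restrict Ω)) atTop (𝓝 0)) := by
  have hp0 : 0 < p := one_pos.trans hp
  obtain ⟨β₀, hβ₀, hββ₀⟩ := hβ_pos
  obtain ⟨C, hC, hsup⟩ := Carnot.exists_abs_le_normX₀ ν hN hΩ_bdd hp hs₀ hsp
  have : IsFiniteMeasure (volume.restrict Ω) := ⟨by simpa using hΩ_bdd.measure_lt_top⟩
  have hβi : IntegrableOn β Ω := hβ.integrable le_top
  have hβ0 : ∀ᵐ x ∂(volume.restrict Ω), 0 ≤ β x := hββ₀.mono fun x hx => hβ₀.le.trans hx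
  have hB : 0 ≤ ∫ x in Ω, β x := integral_nonneg_of_ae hβ0
  have hG : ∀ {t}, 0 ≤ t → 0 ≤ Carnot.primitive g t := Carnot.primitive_nonneg hg hg_nonneg
  refine ⟨fun hosc lam hlam => ?_, fun hosc lam hlam => ?_⟩
  · obtain ⟨w, hw, K, hK⟩ := Carnot.exists_energyFunctional_lt ν hs₀ hs₁ hp hΩ_open hΩ_bdd hΩ_ne
      hlam hβi hβ₀ hββ₀ hg hg_nonneg
    obtain ⟨ε, hε, hsmall⟩ := Carnot.exists_small_primitive_bound (p := p) hC
      (show 0 ≤ p * lam * ∫ x in Ω, β x by positivity)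
    have key : ∀ n : ℕ, ∃ u, (Carnot.IsWeakSolution ν s p Ω β g lam u ∧
        ∀ᵐ x ∂volume, 0 ≤ u x) ∧ (n : ℝ) ≤ Carnot.normX₀ ν s p u := by
      intro n
      -- The functional is at least `-A` on functions of norm at most `n`. Taking `d^p ≥ A` makes
      -- its value at `d w` less than `-A`, which forces the minimiser out of that ball.
      set A := lam * ((∫ x in Ω, β x) * Carnot.primitive g (C * n)) with hA
      obtain ⟨d, hdK, hd⟩ := ((hosc.frequently_gt K).and_eventually
        (eventually_ge_atTop (max 1 A))).exists
      have hd1 : 1 ≤ d := (le_max_left _ _).trans hd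
      have hdA : A ≤ d ^ p := ((le_max_right _ _).trans hd).trans
        (Real.self_le_rpow_of_one_le hd1 hp.le)
      have hd0 : 0 < d := one_pos.trans_le hd1
      obtain ⟨b, hbε, hb⟩ := ((hosc.frequently_lt hε).and_eventually
        (eventually_ge_atTop (max 1 (C * (d * Carnot.normX₀ ν s p w))))).exists
      have hb0 : 0 < b := one_pos.trans_le ((le_max_left _ _).trans hb)
      have hE := hK d hd0 hdK
      have hdp : 0 < d ^ p := by positivity
      obtain ⟨u, hu, hu0, -, huE⟩ := Carnot.exists_solution hN hΩ_open hΩ_bdd hp hs₀ hsp hlam hβi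
        hβ0 hg hg_nonneg hC hsup hb0 (hsmall b _ hb0 (hG hb0.le) hbε) (hw.const_mul hd0.le)
        (by
          rw [Carnot.normX₀_const_mul hp0 hd0.le, le_div_iff₀ hC, mul_comm]
          exact (le_max_right _ _).trans hb)
        (by linarith)
      refine ⟨u, ⟨hu, ae_of_all _ hu0⟩, ?_⟩
      by_contra! hlt
      have hub : ∀ᵐ x ∂volume, |u x| ≤ C * n := (hsup u hu.1).mono fun x hx =>
        hx.trans (mul_le_mul_of_nonneg_left hlt.le hC.le)
      have := Carnot.neg_le_energyFunctional (ν := ν) (s := s) hp0 hlam hβi hβ0 hg hg_nonneg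
        hu.1.1.1.1 hub
      linarith
    choose u hu hun using key
    exact ⟨u, hu, tendsto_atTop_mono hun tendsto_natCast_atTop_atTop⟩
  · obtain ⟨w, hw, K, hK⟩ := Carnot.exists_energyFunctional_lt ν hs₀ hs₁ hp hΩ_open hΩ_bdd hΩ_ne
      hlam hβi hβ₀ hββ₀ hg hg_nonneg
    obtain ⟨ε, hε, hsmall⟩ := Carnot.exists_small_primitive_bound (p := p) hC
      (show 0 ≤ p * lam * ∫ x in Ω, β x by positivity)
    have key : ∀ n : ℕ, ∃ u, (Carnot.IsWeakSolution ν s p Ω β g lam u ∧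
        ∀ᵐ x ∂volume, 0 ≤ u x) ∧ Carnot.normX₀ ν s p u ≤ 1 / ((n : ℝ) + 1) / C := by
      intro n
      -- Here the radius is fixed first, with `b < 1 / (n + 1)`, and `d` is then taken small enough
      -- for `d w` to lie in the ball.
      obtain ⟨b, hbε, hb0, hbn⟩ := ((hosc.frequently_lt hε).and_eventually
        (Ioo_mem_nhdsGT (show (0 : ℝ) < 1 / ((n : ℝ) + 1) by positivity))).exists
      have hw0 := Carnot.normX₀_nonneg (ν := ν) (s := s) (p := p) (u := w)
      obtain ⟨d, hdK, hd0, hdb⟩ := ((hosc.frequently_gt K).and_eventually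
        (Ioo_mem_nhdsGT (show (0 : ℝ) < b / C / (Carnot.normX₀ ν s p w + 1) by
          positivity))).exists
      rw [lt_div_iff₀ (by positivity)] at hdb
      have hE := hK d hd0 hdK
      have hdp : 0 < d ^ p := Real.rpow_pos_of_pos hd0 p
      obtain ⟨u, hu, hu0, hub, -⟩ := Carnot.exists_solution hN hΩ_open hΩ_bdd hp hs₀ hsp hlam hβi
        hβ0 hg hg_nonneg hC hsup hb0 (hsmall b _ hb0 (hG hb0.le) hbε) (hw.const_mul hd0.le)
        (by
          rw [Carnot.normX₀_const_mul hp0 hd0.le]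
          nlinarith)
        (by linarith)
      exact ⟨u, ⟨hu, ae_of_all _ hu0⟩, hub.trans (by gcongr)⟩
    choose u hu hun using key
    have hlim := tendsto_one_div_add_atTop_nhds_zero_nat (𝕜 := ℝ)
    refine ⟨u, hu, ?_, ?_⟩
    · refine squeeze_zero (fun n => Carnot.normX₀_nonneg) hun ?_
      simpa using hlim.div_const C
    · have h1 : ∀ n, eLpNorm (u n) ⊤ (volume.restrict Ω) ≤
          ENNReal.ofReal (1 / ((n : ℝ) + 1)) := fun n => by
        rw [eLpNorm_exponent_top]
        refine eLpNormEssSup_le_of_ae_bound (ae_restrict_of_ae ((hsup _ (hu n).1.1).mono ?_))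
        refine fun x hx => hx.trans ((mul_le_mul_of_nonneg_left (hun n) hC.le).trans (le_of_eq ?_))
        field_simp
      refine tendsto_of_tendsto_of_tendsto_of_le_of_le tendsto_const_nhds ?_
        (fun n => zero_le) h1
      simpa using ENNReal.tendsto_ofReal hlim
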